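/- Let $k$ be a field and let $\mathcal C$ be a small category with a grading $l$, i.e. a functor from $\mathcal C$ to the additive monoid $\mathbb N$ (viewed as a one-object category); so $l(\mathrm{id})=0$ and $l(f\circ g)=l(f)+l(g)$. Assume that $\mathcal C$ is *indiscretely based*: in the subcategory $\mathcal C_0$ of all objects and all morphisms of length $0$, each connected component has exactly one morphism between any two of its objects. Notation. * $k\mathcal C$ is the category algebra: it has the morphisms of $\mathcal C$ as a $k$-basis, the product of two morphisms is their composite $\alpha\beta=\alpha\circ\beta$ if they are composable and $0$ otherwise, and it is graded by $l$. It is unital exactly when $\mathcal C$ has finitely many objects; in that case modules are assumed unital. * For an object $v$, $S_v$ is the simple graded right $k\mathcal C$-module concentrated in degree $0$ with basis $\{e_x : x\cong v\}$, in which a morphism $f:x\to y$ acts by $e_y\cdot f=e_x$ if $f$ is an isomorphism and $y\cong v$, and all other products of a basis vector with a morphism vanish. (Equivalently, $S_v$ is the contravariant representation of $\mathcal C$ that is $k$ on the objects isomorphic to $v$ and $0$ elsewhere, with isomorphisms acting as the identity of $k$ and all other morphisms acting by $0$.) * For $\mathbb Z$-graded right $k\mathcal C$-modules $M,N$ and $m\in\mathbb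 Z$, $\operatorname{Ext}^i_{k\mathcal C}(M,N)_m:=\operatorname{Ext}^i(M,N(m))$ in the abelian category of $\mathbb Z$-graded right $k\mathcal C$-modules and degree-preserving homomorphisms, where $N(m)_j=N_{m+j}$. * For a morphism $p$ of $\mathcal C$, $\mathcal C(p)$ is the semi-simplicial set whose $r$-cells ($r\ge 0$) are the factorizations $p=f_0\circ f_1\circ\dots\circ f_{r+1}$ into non-isomorphisms, modulo isomorphisms of the intermediate objects (that is, $(f_0,\dots,f_{r+1})\sim(f_0\circ h_0,\,h_0^{-1}\circ f_1\circ h_1,\,\dots,\,h_r^{-1}\circ f_{r+1})$ for isomorphisms $h_0,\dots,h_r$), with face operators $\partial_i(f_0,\dots,f_{r+1})=(f_0,\dots,f_i\circ f_{i+1},\dots,f_{r+1})$ for $0\le i\le r$. Its geometric realization is $B\mathcal C(p)$, and $\tilde H^j(B\mathcal C(p))$ is its reduced cellular cohomology with coefficients in $k$: the cohomology of the augmented cochain complex with $k$ in degree $-1$, the $k$-valued functions on $\mathcal C(p)_r$ in degree $r\ge 0$, and differential $(d\varphi)(x)=\sum_i(-1)^i\varphi(\partial_i x)$. In particular $\tilde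 H^{-1}(\emptyset)=k$, and $\tilde H^j=0$ for $j<-1$. Let $v,w$ be objects of $\mathcal C$, $i\ge 0$ and $n\in\mathbb Z$. 1. If $n\neq 0$, there is an isomorphism of $k$-vector spaces $$\operatorname{Ext}^i_{k\mathcal C}(S_w,S_v)_{-n}\;\cong\;\prod_{\substack{p:\,v\to w\\ l(p)=n}}\tilde H^{i-2}(B\mathcal C(p)).$$ If only finitely many of the factors are nonzero (for instance, if there are only finitely many morphisms $v\to w$ of length $n$), then $$\operatorname{Ext}^i_{k\mathcal C}(S_w,S_v)_{-n}\;\cong\;\bigoplus_{\substack{p:\,v\to w\\ l(p)=n}}\tilde H^{i-2}(B\mathcal C(p)).$$ 2. If $n=0$, then $\operatorname{Ext}^i_{k\mathcal C}(S_w,S_v)_0\cong k$ if $i=0$ and $v\cong w$, and it is $0$ otherwise. -/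

import Mathlib

open CategoryTheory CategoryTheory.Limits Opposite

universe w v u

noncomputable section

/-! ### Graded categories -/

/-- An `ℕ`-grading of a category: a functor to the additive monoid `ℕ`, seen as a category with
one object. -/
structure CatGrading (C : Type u) [Category.{v} C] where
  /-- The length of a morphism. -/
  deg : ∀ {x y : C}, (x ⟶ y) → ℕ
  deg_id : ∀ x : C, deg (𝟙 x) = 0
  deg_comp : ∀ {x y z : C} (f : x ⟶ y) (g : y ⟶ z), deg (f ≫ g) = deg f + deg g

namespace CatGrading

variable {C : Type u} [Category.{v} C] (l : CatGrading C)

/-- The property of being a morphism of length zero. -/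
def degZero : MorphismProperty C := fun _ _ f => l.deg f = 0

instance : l.degZero.IsMultiplicative where
  id_mem x := l.deg_id x
  comp_mem f g hf hg := by
    have hf' : l.deg f = 0 := hf
    have hg' : l.deg g = 0 := hg
    show l.deg (f ≫ g) = 0
    rw [l.deg_comp, hf', hg']

/-- The subcategory `C₀` of a graded category: all objects, and the morphisms of length zero. -/
abbrev ZeroPart := WideSubcategory l.degZero

/-- A graded category is indiscretely based if each connected component of `C₀` is an indiscrete
category, that is, has exactly one morphism between any two of its objects. -/
def IsIndiscretelyBased : Prop :=
  ∀ x y : l.ZeroPart, Zigzag x y → Nonempty (Unique (x ⟶ y))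

variable {l}

theorem deg_of_isIso {x y : C} (f : x ⟶ y) [IsIso f] : l.deg f = 0 := by
  have h := l.deg_comp f (inv f)
  rw [IsIso.hom_inv_id, l.deg_id] at h
  omega

theorem IsIndiscretelyBased.isIso (hl : l.IsIndiscretelyBased) {x y : C} (f : x ⟶ y)
    (hf : l.deg f = 0) : IsIso f := by
  let X : l.ZeroPart := ⟨x⟩
  let Y : l.ZeroPart := ⟨y⟩
  let F : X ⟶ Y := ⟨f, hf⟩
  have z : Zigzag X Y := Zigzag.of_hom F
  have z' : Zigzag Y X := Zigzag.of_inv F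
  obtain ⟨u⟩ := hl Y X z'
  let G : Y ⟶ X := u.default
  obtain ⟨uX⟩ := hl X X (Zigzag.refl X)
  obtain ⟨uY⟩ := hl Y Y (Zigzag.refl Y)
  have h1 : F ≫ G = 𝟙 X := Subsingleton.elim _ _
  have h2 : G ≫ F = 𝟙 Y := Subsingleton.elim _ _
  exact ⟨G.hom, congrArg InducedWideCategory.Hom.hom h1, congrArg InducedWideCategory.Hom.hom h2⟩

theorem IsIndiscretelyBased.isIso_iff (hl : l.IsIndiscretelyBased) {x y : C} (f : x ⟶ y) :
    IsIso f ↔ l.deg f = 0 :=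
  ⟨fun _ => deg_of_isIso f, hl.isIso f⟩

end CatGrading

/-! ### The category algebra -/

/-- A morphism of `C` together with its source and its target. -/
structure CatMor (C : Type u) [Category.{v} C] where
  /-- the source (tail) -/
  src : C
  /-- the target (head) -/
  tgt : C
  /-- the morphism -/
  hom : src ⟶ tgt

/-- The category algebra `k C`, as a `k`-module: the free module on the morphisms of `C`. -/
def CatAlg (k : Type w) [Field k] (C : Type u) [Category.{v} C] := CatMor C →₀ k

namespace CatAlg

variable {k : Type w} [Field k] {C : Type u} [Category.{v} C]

instance : AddCommGroup (CatAlg k C) := inferInstanceAs (AddCommGroup (CatMor C →₀ k))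
instance : Module k (CatAlg k C) := inferInstanceAs (Module k (CatMor C →₀ k))

/-- The basis element of the category algebra given by a morphism. -/
def of (k : Type w) [Field k] (a : CatMor C) : CatAlg k C := Finsupp.single a 1

open Classical in
/-- The product of two basis elements: the composite `a ∘ b` (first `b`, then `a`) if `a` and `b`
are composable, and zero otherwise. -/
def mulBasis (k : Type w) [Field k] (a b : CatMor C) : CatAlg k C :=
  if h : b.tgt = a.src then of k ⟨b.src, a.tgt, b.hom ≫ eqToHom h ≫ a.hom⟩ else 0

/-- The linear map on the category algebra with prescribed values on the basis. -/
def lin {M : Type*} [AddCommGroup M] [Module k M] (f : CatMor C → M) : CatAlg k C →ₗ[k] M :=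
  (Finsupp.linearCombination k f : (CatMor C →₀ k) →ₗ[k] M)

@[simp] theorem lin_of {M : Type*} [AddCommGroup M] [Module k M] (f : CatMor C → M)
    (a : CatMor C) : lin f (of k a) = f a :=
  (Finsupp.linearCombination_single k (1 : k) a).trans (one_smul k _)

/-- The `k`-bilinear multiplication of the category algebra. -/
def mulLin : CatAlg k C →ₗ[k] CatAlg k C →ₗ[k] CatAlg k C :=
  lin fun a => lin fun b => mulBasis k a b

instance : Mul (CatAlg k C) := ⟨fun a b => mulLin a b⟩

theorem mul_def (a b : CatAlg k C) : a * b = mulLin a b := rfl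

theorem of_mul_of (a b : CatMor C) : of k a * of k b = mulBasis k a b := by
  rw [mul_def, mulLin, lin_of, lin_of]

theorem span_of : Submodule.span k (Set.range (of k : CatMor C → CatAlg k C)) = ⊤ := by
  have h := (Finsupp.basisSingleOne (R := k) (ι := CatMor C)).span_eq
  have e : (⇑(Finsupp.basisSingleOne (R := k) (ι := CatMor C))) = of k := by
    funext a
    simp [of]
  rw [e] at h
  exact h

theorem ext_of {M : Type*} [AddCommGroup M] [Module k M] {f g : CatAlg k C →ₗ[k] M}
    (h : ∀ a, f (of k a) = g (of k a)) : f = g :=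
  LinearMap.ext_on span_of (by rintro _ ⟨a, rfl⟩; exact h a)

theorem mulBasis_assoc (a b c : CatMor C) :
    mulLin (mulBasis k a b) (of k c) = mulLin (of k a) (mulBasis k b c) := by
  obtain ⟨a0, a1, a⟩ := a
  obtain ⟨b0, b1, b⟩ := b
  obtain ⟨c0, c1, c⟩ := c
  by_cases h : b1 = a0
  · subst h
    by_cases h' : c1 = b0
    · subst h'
      simp only [mulBasis, dif_pos, ← mul_def, of_mul_of, eqToHom_refl, Category.id_comp,
        Category.assoc]
    · simp only [mulBasis, dif_pos, ← mul_def, of_mul_of, dif_neg h']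
      simp [mul_def]
  · by_cases h' : c1 = b0
    · subst h'
      simp only [mulBasis, dif_pos, ← mul_def, of_mul_of, dif_neg h]
      simp [mul_def]
    · simp only [mulBasis, dif_neg h, dif_neg h']
      simp

protected theorem mul_assoc (a b c : CatAlg k C) : a * b * c = a * (b * c) := by
  have h1 : ∀ (x y : CatMor C) (c : CatAlg k C),
      mulLin (mulLin (of k x) (of k y)) c = mulLin (of k x) (mulLin (of k y) c) := by
    intro x y c
    refine LinearMap.congr_fun (ext_of (f := mulLin (mulLin (of k x) (of k y)))
      (g := (mulLin (of k x)).comp (mulLin (of k y))) fun z => ?_) c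
    have := mulBasis_assoc (k := k) x y z
    rwa [← of_mul_of, ← of_mul_of] at this
  have h2 : ∀ (x : CatMor C) (b c : CatAlg k C),
      mulLin (mulLin (of k x) b) c = mulLin (of k x) (mulLin b c) := fun x b c =>
    LinearMap.congr_fun (ext_of (f := (mulLin.flip c).comp (mulLin (of k x)))
      (g := (mulLin (of k x)).comp (mulLin.flip c)) fun y => h1 x y c) b
  exact LinearMap.congr_fun (ext_of (f := (mulLin.flip c).comp (mulLin.flip b))
      (g := mulLin.flip (mulLin b c)) fun x => h2 x b c) a

/-- The category algebra is an associative, in general non-unital, `k`-algebra. -/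
instance : NonUnitalRing (CatAlg k C) where
  left_distrib a b c := by simp [mul_def]
  right_distrib a b c := by simp [mul_def]
  zero_mul a := by simp [mul_def]
  mul_zero a := by simp [mul_def]
  mul_assoc := CatAlg.mul_assoc

instance : IsScalarTower k (CatAlg k C) (CatAlg k C) :=
  ⟨fun r a b => by simp [mul_def]⟩

instance : SMulCommClass k (CatAlg k C) (CatAlg k C) :=
  ⟨fun r a b => by simp [mul_def]⟩

/-- The homogeneous component of degree `d` of the category algebra of a graded category: the span
of the morphisms of length `d`. -/
def homog (k : Type w) [Field k] (l : CatGrading C) (d : ℕ) : Submodule k (CatAlg k C) :=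
  Submodule.span k (of k '' {a | l.deg a.hom = d})

theorem of_mem_homog (l : CatGrading C) (a : CatMor C) : of k a ∈ homog k l (l.deg a.hom) :=
  Submodule.subset_span ⟨a, rfl, rfl⟩

theorem mul_mem_homog {l : CatGrading C} {d e : ℕ} {a b : CatAlg k C} (ha : a ∈ homog k l d)
    (hb : b ∈ homog k l e) : a * b ∈ homog k l (d + e) := by
  induction ha using Submodule.span_induction with
  | zero => simp
  | add x y _ _ hx hy => rw [add_mul]; exact add_mem hx hy
  | smul r x _ hx => rw [smul_mul_assoc]; exact Submodule.smul_mem _ r hx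
  | mem x hx =>
    obtain ⟨α, hα, rfl⟩ := hx
    induction hb using Submodule.span_induction with
    | zero => simp
    | add x y _ _ hx hy => rw [mul_add]; exact add_mem hx hy
    | smul r x _ hx => rw [mul_smul_comm]; exact Submodule.smul_mem _ r hx
    | mem y hy =>
      obtain ⟨β, hβ, rfl⟩ := hy
      obtain ⟨a0, a1, α⟩ := α
      obtain ⟨b0, b1, β⟩ := β
      rw [of_mul_of, mulBasis]
      split_ifs with h
      · dsimp only at h
        subst h
        refine Submodule.subset_span ⟨_, ?_, rfl⟩
        simp only [Set.mem_ofPred_eq] at hα hβ ⊢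
        simp only [eqToHom_refl, Category.id_comp, l.deg_comp, hα, hβ, add_comm]
      · exact zero_mem _

end CatAlg

/-! ### Graded right modules over the category algebra -/

/-- A `ℤ`-graded right module `M = ⨁ᵢ Mᵢ` over the graded category algebra `k C`: an associative
right action with components `Mᵢ × (k C)_d → M_{i + d}`. If `k C` has a unit (that is, if `C` has
finitely many objects), the unit is required to act as the identity. -/
structure GrMod (k : Type w) [Field k] {C : Type u} [Category.{v} C] (l : CatGrading C) where
  /-- the homogeneous components -/
  piece : ℤ → Type (max u v w)
  [grp : ∀ i, AddCommGroup (piece i)]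
  [mod : ∀ i, Module k (piece i)]
  /-- the right action -/
  act : ∀ {i : ℤ} {d : ℕ} {j : ℤ}, i + d = j →
    (piece i →ₗ[k] CatAlg.homog k l d →ₗ[k] piece j)
  act_act : ∀ {i : ℤ} {d : ℕ} {j : ℤ} {e : ℕ} {m : ℤ} (h : i + d = j) (h' : j + e = m)
    (h'' : i + ((d + e : ℕ) : ℤ) = m) (x : piece i) (a : CatAlg.homog k l d)
    (b : CatAlg.homog k l e),
    act h' (act h x a) b = act h'' x ⟨a.1 * b.1, CatAlg.mul_mem_homog a.2 b.2⟩
  act_unit : ∀ (e : CatAlg.homog k l 0), (∀ a : CatAlg k C, e.1 * a = a ∧ a * e.1 = a) →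
    ∀ {i : ℤ} (h : i + ((0 : ℕ) : ℤ) = i) (x : piece i), act h x e = x

namespace GrMod

attribute [instance] GrMod.grp GrMod.mod

variable {k : Type w} [Field k] {C : Type u} [Category.{v} C] {l : CatGrading C}

/-- Homomorphisms of graded right `k C`-modules: `k C`-linear maps that preserve degrees. -/
@[ext]
structure Hom (M N : GrMod.{w, v, u} k l) : Type (max u v w) where
  /-- the components -/
  app : ∀ i, M.piece i →ₗ[k] N.piece i
  app_act : ∀ {i : ℤ} {d : ℕ} {j : ℤ} (h : i + d = j) (x : M.piece i) (a : CatAlg.homog k l d),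
    app j (M.act h x a) = N.act h (app i x) a

instance : Category.{max u v w} (GrMod.{w, v, u} k l) where
  Hom M N := Hom M N
  id M := ⟨fun _ => LinearMap.id, fun _ _ _ => rfl⟩
  comp f g := ⟨fun i => (g.app i).comp (f.app i), fun h x a => by
    simp only [LinearMap.comp_apply, f.app_act, g.app_act]⟩

@[ext]
theorem hom_ext {M N : GrMod.{w, v, u} k l} {f g : M ⟶ N}
    (h : ∀ i x, f.app i x = g.app i x) : f = g :=
  Hom.ext (funext fun i => LinearMap.ext (h i))

@[simp] theorem id_app (M : GrMod.{w, v, u} k l) (i : ℤ) (x : M.piece i) :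
    Hom.app (𝟙 M) i x = x := rfl

@[simp] theorem comp_app {M N P : GrMod.{w, v, u} k l} (f : M ⟶ N) (g : N ⟶ P) (i : ℤ)
    (x : M.piece i) : (f ≫ g).app i x = g.app i (f.app i x) := rfl

section Linear

variable {M N : GrMod.{w, v, u} k l}

instance : Zero (M ⟶ N) := ⟨⟨fun _ => 0, fun _ _ _ => by simp⟩⟩
instance : Add (M ⟶ N) := ⟨fun f g => ⟨fun i => f.app i + g.app i, fun h x a => by
  simp [f.app_act, g.app_act]⟩⟩
instance : Neg (M ⟶ N) := ⟨fun f => ⟨fun i => -f.app i, fun h x a => by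
  simp [f.app_act]⟩⟩
instance : Sub (M ⟶ N) := ⟨fun f g => ⟨fun i => f.app i - g.app i, fun h x a => by
  simp [f.app_act, g.app_act]⟩⟩
instance : SMul ℕ (M ⟶ N) := ⟨fun r f => ⟨fun i => r • f.app i, fun h x a => by
  simp [f.app_act]⟩⟩
instance : SMul ℤ (M ⟶ N) := ⟨fun r f => ⟨fun i => r • f.app i, fun h x a => by
  simp [f.app_act]⟩⟩
instance : SMul k (M ⟶ N) := ⟨fun r f => ⟨fun i => r • f.app i, fun h x a => by
  simp [f.app_act]⟩⟩

@[simp] theorem zero_app (i : ℤ) (x : M.piece i) : Hom.app (0 : M ⟶ N) i x = 0 := rfl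
@[simp] theorem add_app (f g : M ⟶ N) (i : ℤ) (x : M.piece i) :
    Hom.app (f + g) i x = f.app i x + g.app i x := rfl
@[simp] theorem neg_app (f : M ⟶ N) (i : ℤ) (x : M.piece i) :
    Hom.app (-f) i x = -f.app i x := rfl
@[simp] theorem sub_app (f g : M ⟶ N) (i : ℤ) (x : M.piece i) :
    Hom.app (f - g) i x = f.app i x - g.app i x := rfl
@[simp] theorem smul_app (r : k) (f : M ⟶ N) (i : ℤ) (x : M.piece i) :
    Hom.app (r • f) i x = r • f.app i x := rfl

theorem app_injective :
    Function.Injective (fun f : M ⟶ N => (f.app : ∀ i, M.piece i →ₗ[k] N.piece i)) :=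
  fun _ _ h => Hom.ext h

instance : AddCommGroup (M ⟶ N) :=
  app_injective.addCommGroup _ rfl (fun _ _ => rfl) (fun _ => rfl) (fun _ _ => rfl)
    (fun _ _ => rfl) (fun _ _ => rfl)

instance : Module k (M ⟶ N) :=
  app_injective.module k ⟨⟨_, rfl⟩, fun _ _ => rfl⟩ (fun _ _ => rfl)

instance : Preadditive (GrMod.{w, v, u} k l) where
  add_comp _ _ _ f f' g := by ext i x; simp
  comp_add _ _ _ f g g' := by ext i x; simp

instance : CategoryTheory.Linear k (GrMod.{w, v, u} k l) where
  smul_comp _ _ _ r f g := by ext i x; simp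
  comp_smul _ _ _ f r g := by ext i x; simp

end Linear

/-! #### The abelian category of graded right modules -/

section Abelian

variable {M N : GrMod.{w, v, u} k l}

/-- The graded submodule given by a stable family of subspaces. -/
def sub (M : GrMod.{w, v, u} k l) (S : ∀ i, Submodule k (M.piece i))
    (hS : ∀ {i : ℤ} {d : ℕ} {j : ℤ} (h : i + d = j) (x : M.piece i) (a : CatAlg.homog k l d),
      x ∈ S i → M.act h x a ∈ S j) : GrMod.{w, v, u} k l where
  piece i := S i
  act {i d j} h := LinearMap.mk₂ k (fun x a => ⟨M.act h x.1 a, hS h x.1 a x.2⟩)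
    (fun _ _ _ => Subtype.ext (by simp)) (fun _ _ _ => Subtype.ext (by simp))
    (fun _ _ _ => Subtype.ext (by simp)) (fun _ _ _ => Subtype.ext (by simp))
  act_act h h' h'' x a b := Subtype.ext (M.act_act h h' h'' x.1 a b)
  act_unit e he i h x := Subtype.ext (M.act_unit e he h x.1)

/-- The quotient by the graded submodule given by a stable family of subspaces. -/
def quot (M : GrMod.{w, v, u} k l) (S : ∀ i, Submodule k (M.piece i))
    (hS : ∀ {i : ℤ} {d : ℕ} {j : ℤ} (h : i + d = j) (x : M.piece i) (a : CatAlg.homog k l d),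
      x ∈ S i → M.act h x a ∈ S j) : GrMod.{w, v, u} k l where
  piece i := M.piece i ⧸ S i
  act {i d j} h := (S i).liftQ ((M.act h).compr₂ (S j).mkQ) (fun x hx => by
    ext a
    simpa using hS h x a hx)
  act_act h h' h'' x a b := by
    obtain ⟨x, rfl⟩ := Submodule.mkQ_surjective _ x
    exact congrArg _ (M.act_act h h' h'' x a b)
  act_unit e he i h x := by
    obtain ⟨x, rfl⟩ := Submodule.mkQ_surjective _ x
    exact congrArg _ (M.act_unit e he h x)

/-- The product of a finite family of graded modules. -/
def prod {n : ℕ} (F : Fin n → GrMod.{w, v, u} k l) : GrMod.{w, v, u} k l where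
  piece i := ∀ t, (F t).piece i
  act {i d j} h := LinearMap.mk₂ k (fun x a t => (F t).act h (x t) a)
    (fun _ _ _ => funext fun t => by simp) (fun _ _ _ => funext fun t => by simp)
    (fun _ _ _ => funext fun t => by simp) (fun _ _ _ => funext fun t => by simp)
  act_act h h' h'' x a b := funext fun t => (F t).act_act h h' h'' (x t) a b
  act_unit e he i h x := funext fun t => (F t).act_unit e he h (x t)

/-- The kernel of a homomorphism. -/
def ker (f : M ⟶ N) : GrMod.{w, v, u} k l :=
  M.sub (fun i => LinearMap.ker (f.app i)) (fun h x a hx => by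
    rw [LinearMap.mem_ker] at hx ⊢
    rw [f.app_act, hx]
    simp)

/-- The inclusion of the kernel. -/
def kerι (f : M ⟶ N) : ker f ⟶ M := ⟨fun _ => Submodule.subtype _, fun _ _ _ => rfl⟩

theorem kerι_comp (f : M ⟶ N) : kerι f ≫ f = 0 := by
  ext i x
  exact x.2

/-- The factorization through the kernel. -/
def kerLift (f : M ⟶ N) {T : GrMod.{w, v, u} k l} (g : T ⟶ M) (hg : g ≫ f = 0) : T ⟶ ker f :=
  ⟨fun i => (g.app i).codRestrict _ fun x => congrArg (fun q : T ⟶ N => q.app i x) hg,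
    fun h x a => Subtype.ext (g.app_act h x a)⟩

/-- The kernel has its universal property. -/
def kerIsLimit (f : M ⟶ N) : IsLimit (KernelFork.ofι (kerι f) (kerι_comp f)) :=
  KernelFork.IsLimit.ofι _ _ (fun g hg => kerLift f g hg) (fun _ _ => rfl)
    (fun g hg m hm => by
      subst hm
      rfl)

instance : HasKernels (GrMod.{w, v, u} k l) := ⟨fun f => ⟨⟨⟨_, kerIsLimit f⟩⟩⟩⟩

/-- The cokernel of a homomorphism. -/
def coker (f : M ⟶ N) : GrMod.{w, v, u} k l :=
  N.quot (fun i => LinearMap.range (f.app i)) (fun h x a hx => by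
    obtain ⟨y, rfl⟩ := hx
    exact ⟨M.act h y a, f.app_act h y a⟩)

/-- The projection to the cokernel. -/
def cokerπ (f : M ⟶ N) : N ⟶ coker f := ⟨fun _ => Submodule.mkQ _, fun _ _ _ => rfl⟩

theorem comp_cokerπ (f : M ⟶ N) : f ≫ cokerπ f = 0 := by
  ext i x
  exact (Submodule.Quotient.mk_eq_zero _).2 ⟨x, rfl⟩

/-- The factorization through the cokernel. -/
def cokerDesc (f : M ⟶ N) {T : GrMod.{w, v, u} k l} (g : N ⟶ T) (hg : f ≫ g = 0) :
    coker f ⟶ T :=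
  ⟨fun i => (LinearMap.range (f.app i)).liftQ (g.app i) (by
      rintro _ ⟨x, rfl⟩
      exact congrArg (fun q : M ⟶ T => q.app i x) hg),
    fun h x a => by
      obtain ⟨x, rfl⟩ := Submodule.mkQ_surjective _ x
      exact g.app_act h x a⟩

theorem epi_of_surjective (f : M ⟶ N) (hf : ∀ i, Function.Surjective (f.app i)) : Epi f where
  left_cancellation g g' h := by
    ext i y
    obtain ⟨x, rfl⟩ := hf i y
    exact congrArg (fun q : M ⟶ _ => q.app i x) h

/-- The cokernel has its universal property. -/
def cokerIsColimit (f : M ⟶ N) : IsColimit (CokernelCofork.ofπ (cokerπ f) (comp_cokerπ f)) :=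
  CokernelCofork.IsColimit.ofπ _ _ (fun g hg => cokerDesc f g hg) (fun _ _ => rfl)
    (fun g hg m hm => by
      have : Epi (cokerπ f) := epi_of_surjective _ fun i => Submodule.mkQ_surjective _
      rw [← cancel_epi (cokerπ f), hm]
      rfl)

instance : HasCokernels (GrMod.{w, v, u} k l) := ⟨fun f => ⟨⟨⟨_, cokerIsColimit f⟩⟩⟩⟩

theorem injective_of_mono (f : M ⟶ N) [Mono f] (i : ℤ) : Function.Injective (f.app i) := by
  have h : kerι f = 0 := by
    rw [← cancel_mono f, kerι_comp, zero_comp]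
  refine (injective_iff_map_eq_zero _).2 fun x hx => ?_
  exact congrArg (fun q : ker f ⟶ M => q.app i ⟨x, hx⟩) h

theorem surjective_of_epi (f : M ⟶ N) [Epi f] (i : ℤ) : Function.Surjective (f.app i) := by
  have h : cokerπ f = 0 := by
    rw [← cancel_epi f, comp_cokerπ, comp_zero]
  intro y
  have hy : (LinearMap.range (f.app i)).mkQ y = 0 :=
    congrArg (fun q : N ⟶ coker f => q.app i y) h
  exact (Submodule.Quotient.mk_eq_zero _).1 hy

/-- The factorization through a componentwise injective map. -/
def injLift (f : M ⟶ N) (hf : ∀ i, Function.Injective (f.app i)) {T : GrMod.{w, v, u} k l}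
    (g : T ⟶ N) (hg : g ≫ cokerπ f = 0) : T ⟶ M :=
  have hm : ∀ i x, g.app i x ∈ LinearMap.range (f.app i) := fun i x =>
    (Submodule.Quotient.mk_eq_zero _).1 (congrArg (fun q : T ⟶ coker f => q.app i x) hg)
  have hs : ∀ i x, f.app i ((LinearEquiv.ofInjective (f.app i) (hf i)).symm ⟨g.app i x, hm i x⟩) =
      g.app i x := fun i x => congrArg Subtype.val
    ((LinearEquiv.ofInjective (f.app i) (hf i)).apply_symm_apply ⟨g.app i x, hm i x⟩)
  ⟨fun i => (LinearEquiv.ofInjective (f.app i) (hf i)).symm.toLinearMap.comp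
      ((g.app i).codRestrict _ (hm i)),
    fun {i d j} h x a => hf j (by
      rw [f.app_act]
      refine (hs j _).trans ?_
      rw [g.app_act]
      exact congrArg (fun y => N.act h y a) (hs i x).symm)⟩

theorem injLift_comp (f : M ⟶ N) (hf : ∀ i, Function.Injective (f.app i))
    {T : GrMod.{w, v, u} k l} (g : T ⟶ N) (hg : g ≫ cokerπ f = 0) : injLift f hf g hg ≫ f = g := by
  ext i x
  exact congrArg Subtype.val ((LinearEquiv.ofInjective (f.app i) (hf i)).apply_symm_apply _)

theorem ker_le_ker (f : M ⟶ N) {T : GrMod.{w, v, u} k l} (g : M ⟶ T) (hg : kerι f ≫ g = 0)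
    (i : ℤ) : LinearMap.ker (f.app i) ≤ LinearMap.ker (g.app i) := fun x hx =>
  congrArg (fun q : ker f ⟶ T => q.app i ⟨x, hx⟩) hg

theorem liftQ_symm (f : M ⟶ N) (hf : ∀ i, Function.Surjective (f.app i))
    {T : GrMod.{w, v, u} k l} (g : M ⟶ T) (hg : kerι f ≫ g = 0) (i : ℤ) (x : M.piece i) :
    ((LinearMap.ker (f.app i)).liftQ (g.app i) (ker_le_ker f g hg i))
      (((f.app i).quotKerEquivOfSurjective (hf i)).symm (f.app i x)) = g.app i x := by
  have : ((f.app i).quotKerEquivOfSurjective (hf i)).symm (f.app i x) =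
      Submodule.Quotient.mk x := by
    rw [LinearEquiv.symm_apply_eq]
    rfl
  rw [this]
  rfl

/-- The factorization through a componentwise surjective map. -/
def surjDesc (f : M ⟶ N) (hf : ∀ i, Function.Surjective (f.app i)) {T : GrMod.{w, v, u} k l}
    (g : M ⟶ T) (hg : kerι f ≫ g = 0) : N ⟶ T :=
  ⟨fun i => ((LinearMap.ker (f.app i)).liftQ (g.app i) (ker_le_ker f g hg i)).comp
      ((f.app i).quotKerEquivOfSurjective (hf i)).symm.toLinearMap,
    fun {i d j} h y a => by
      obtain ⟨x, rfl⟩ := hf i y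
      rw [← f.app_act]
      refine (liftQ_symm f hf g hg j _).trans ?_
      rw [g.app_act]
      exact congrArg (fun y => T.act h y a) (liftQ_symm f hf g hg i x).symm⟩

theorem comp_surjDesc (f : M ⟶ N) (hf : ∀ i, Function.Surjective (f.app i))
    {T : GrMod.{w, v, u} k l} (g : M ⟶ T) (hg : kerι f ≫ g = 0) : f ≫ surjDesc f hf g hg = g := by
  ext i x
  exact liftQ_symm f hf g hg i x

/-- Every monomorphism is the kernel of its cokernel. -/
abbrev normalMono (f : M ⟶ N) [Mono f] : NormalMono f where
  Z := coker f
  g := cokerπ f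
  w := comp_cokerπ f
  isLimit := KernelFork.IsLimit.ofι _ _ (fun g hg => injLift f (injective_of_mono f) g hg)
    (fun g hg => injLift_comp f _ g hg)
    (fun g hg m hm => by rw [← cancel_mono f, hm, injLift_comp])

/-- Every epimorphism is the cokernel of its kernel. -/
abbrev normalEpi (f : M ⟶ N) [Epi f] : NormalEpi f where
  W := ker f
  g := kerι f
  w := kerι_comp f
  isColimit := CokernelCofork.IsColimit.ofπ _ _
    (fun g hg => surjDesc f (surjective_of_epi f) g hg)
    (fun g hg => comp_surjDesc f _ g hg)
    (fun g hg m hm => by rw [← cancel_epi f, hm, comp_surjDesc])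

/-- The projections of a finite product. -/
def prodπ {n : ℕ} (F : Fin n → GrMod.{w, v, u} k l) (t : Fin n) : prod F ⟶ F t :=
  ⟨fun _ => LinearMap.proj t, fun _ _ _ => rfl⟩

/-- The finite product has its universal property. -/
def prodIsLimit {n : ℕ} (F : Fin n → GrMod.{w, v, u} k l) : IsLimit (Fan.mk (prod F) (prodπ F)) :=
  Fan.IsLimit.mk _
    (fun g => ⟨fun i => LinearMap.pi fun t => (g.proj t).app i,
      fun h x a => funext fun t => (g.proj t).app_act h x a⟩)
    (fun _ _ => rfl)
    (fun g m hm => by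
      ext i x
      funext t
      exact congrArg (fun q => Hom.app q i x) (hm t))

instance : HasFiniteProducts (GrMod.{w, v, u} k l) :=
  ⟨fun _ => ⟨fun K =>
    have : HasProduct (fun t => K.obj ⟨t⟩) := ⟨⟨⟨_, prodIsLimit fun t => K.obj ⟨t⟩⟩⟩⟩
    have : HasLimit (Discrete.functor (K.obj ∘ Discrete.mk)) := this
    hasLimit_of_iso Discrete.natIsoFunctor.symm⟩⟩

instance : Abelian (GrMod.{w, v, u} k l) where
  normalMonoOfMono f _ := ⟨normalMono f⟩
  normalEpiOfEpi f _ := ⟨normalEpi f⟩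

instance : HasExt.{(max u v w) + 1} (GrMod.{w, v, u} k l) := HasExt.standard _

end Abelian

/-- The shift `M(n)` of a graded module, with components `M(n)ᵢ = M_{n + i}`. -/
def shift (M : GrMod.{w, v, u} k l) (n : ℤ) : GrMod.{w, v, u} k l where
  piece i := M.piece (n + i)
  act h := M.act (by omega)
  act_act h h' h'' x a b := M.act_act (by omega) (by omega) (by omega) x a b
  act_unit e he _ h x := M.act_unit e he (by omega) x

end GrMod

/-- The graded Ext group `Ext^i_{kC}(M, N)_n = Ext^i(M, N(n))`, a vector space over `k`, where
the right hand side is the Ext group in the abelian category of graded right `k C`-modules. -/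
abbrev GrExt {k : Type w} [Field k] {C : Type u} [Category.{v} C] {l : CatGrading C}
    (M N : GrMod.{w, v, u} k l) (i : ℕ) (n : ℤ) : Type ((max u v w) + 1) :=
  Abelian.Ext M (N.shift n) i

/-! ### The simple modules -/

namespace GrMod

variable (k : Type w) [Field k] {C : Type u} [Category.{v} C] (l : CatGrading C)

/-- The basis of the degree `j` component of the simple module of `c`: the objects isomorphic to
`c` if `j = 0`, and empty otherwise. -/
@[ext]
structure SimpleIdx (c : C) (j : ℤ) : Type (max u v) where
  /-- an object isomorphic to `c` -/
  obj : C
  iso : Nonempty (obj ≅ c)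
  deg_eq : j = 0

variable {k l}

open Classical in
/-- The action of a morphism `a : x → y` on the basis vector at an object `z`: the basis vector at
`x` if `y = z` and `a` is an isomorphism, and zero otherwise. -/
def simpleBasisAct (k : Type w) [Field k] (c : C) {i : ℤ} (j : ℤ) (s : SimpleIdx c i)
    (a : CatMor C) : SimpleIdx c j →₀ k :=
  if h : (a.tgt = s.obj ∧ IsIso a.hom) ∧ j = 0 then
    Finsupp.single ⟨a.src, have := h.1.2; ⟨(asIso a.hom ≪≫ eqToIso h.1.1) ≪≫ s.iso.some⟩, h.2⟩ 1
  else 0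

/-- The bilinear extension of the action on basis vectors. -/
def simpleAct (k : Type w) [Field k] (c : C) (i j : ℤ) :
    (SimpleIdx c i →₀ k) →ₗ[k] CatAlg k C →ₗ[k] (SimpleIdx c j →₀ k) :=
  Finsupp.linearCombination k fun s => CatAlg.lin fun a => simpleBasisAct k c j s a

theorem simpleAct_of (c : C) {i : ℤ} (j : ℤ) (s : SimpleIdx c i) (a : CatMor C) :
    simpleAct k c i j (Finsupp.single s 1) (CatAlg.of k a) = simpleBasisAct k c j s a := by
  rw [simpleAct, Finsupp.linearCombination_single, one_smul, CatAlg.lin_of]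

theorem simpleAct_assoc_of (hl : l.IsIndiscretelyBased) (c : C) {i j m : ℤ} (s : SimpleIdx c i)
    (a b : CatMor C) (h : i + l.deg a.hom = j) (h' : j + l.deg b.hom = m) :
    simpleAct k c j m (simpleAct k c i j (Finsupp.single s 1) (CatAlg.of k a)) (CatAlg.of k b) =
      simpleAct k c i m (Finsupp.single s 1) (CatAlg.of k a * CatAlg.of k b) := by
  have hi := s.deg_eq
  obtain ⟨a0, a1, a⟩ := a
  obtain ⟨b0, b1, b⟩ := b
  dsimp only at h h'
  rw [simpleAct_of, CatAlg.of_mul_of]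
  by_cases hab : b1 = a0
  · subst hab
    simp only [CatAlg.mulBasis, dif_pos, eqToHom_refl, Category.id_comp, simpleAct_of]
    by_cases ha : (a1 = s.obj ∧ IsIso a) ∧ j = 0
    · have hiso : IsIso (b ≫ a) ↔ IsIso b := by
        rw [hl.isIso_iff, hl.isIso_iff, l.deg_comp, (hl.isIso_iff a).1 ha.1.2, add_zero]
      rw [simpleBasisAct, dif_pos ha, simpleAct_of]
      by_cases hb : IsIso b ∧ m = 0
      · rw [simpleBasisAct, dif_pos ⟨⟨rfl, hb.1⟩, hb.2⟩, simpleBasisAct,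
          dif_pos ⟨⟨ha.1.1, hiso.2 hb.1⟩, hb.2⟩]
      · rw [simpleBasisAct, dif_neg fun q => hb ⟨q.1.2, q.2⟩, simpleBasisAct,
          dif_neg fun q => hb ⟨hiso.1 q.1.2, q.2⟩]
    · rw [simpleBasisAct, dif_neg ha, map_zero, LinearMap.zero_apply, simpleBasisAct, dif_neg]
      rintro ⟨⟨h1, h2⟩, h3⟩
      have h4 := (hl.isIso_iff _).1 h2
      rw [l.deg_comp] at h4
      exact ha ⟨⟨h1, hl.isIso a (by omega)⟩, by omega⟩
  · simp only [CatAlg.mulBasis, dif_neg hab, map_zero]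
    by_cases ha : (a1 = s.obj ∧ IsIso a) ∧ j = 0
    · rw [simpleBasisAct, dif_pos ha, simpleAct_of, simpleBasisAct, dif_neg]
      exact fun q => hab q.1.1
    · rw [simpleBasisAct, dif_neg ha, map_zero, LinearMap.zero_apply]

theorem simpleAct_assoc (hl : l.IsIndiscretelyBased) (c : C) {i : ℤ} {d : ℕ} {j : ℤ} {e : ℕ}
    {m : ℤ} (h : i + d = j) (h' : j + e = m) (x : SimpleIdx c i →₀ k) {a b : CatAlg k C}
    (ha : a ∈ CatAlg.homog k l d) (hb : b ∈ CatAlg.homog k l e) :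
    simpleAct k c j m (simpleAct k c i j x a) b = simpleAct k c i m x (a * b) := by
  induction ha using Submodule.span_induction with
  | zero => simp
  | add x y _ _ hx hy => simp [add_mul, hx, hy]
  | smul r x _ hx => simp [smul_mul_assoc, hx]
  | mem y hy =>
    obtain ⟨α, rfl, rfl⟩ := hy
    induction hb using Submodule.span_induction with
    | zero => simp
    | add x y _ _ hx hy => simp [mul_add, hx, hy]
    | smul r x _ hx => simp [mul_smul_comm, hx]
    | mem y hy =>
      obtain ⟨β, rfl, rfl⟩ := hy
      induction x using Finsupp.induction_linear with
      | zero => simp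
      | add x y hx hy => simp [hx, hy]
      | single s r =>
        have := simpleAct_assoc_of (k := k) hl c s α β h h'
        rw [← mul_one r, ← smul_eq_mul, ← Finsupp.smul_single]
        simp only [map_smul, LinearMap.smul_apply, this]

theorem simpleAct_unit (c : C) {i : ℤ} (x : SimpleIdx c i →₀ k) (e : CatAlg k C)
    (he : ∀ a : CatAlg k C, e * a = a ∧ a * e = a)
    (hassoc : ∀ (y : SimpleIdx c i →₀ k) (z : C),
      simpleAct k c i i (simpleAct k c i i y (CatAlg.of k ⟨z, z, 𝟙 z⟩)) e =
        simpleAct k c i i y (CatAlg.of k ⟨z, z, 𝟙 z⟩ * e)) :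
    simpleAct k c i i x e = x := by
  induction x using Finsupp.induction_linear with
  | zero => simp
  | add x y hx hy => simp [hx, hy]
  | single s r =>
    have hid : simpleAct k c i i (Finsupp.single s r) (CatAlg.of k ⟨s.obj, s.obj, 𝟙 s.obj⟩) =
        Finsupp.single s r := by
      rw [← mul_one r, ← smul_eq_mul, ← Finsupp.smul_single]
      simp only [map_smul, LinearMap.smul_apply, simpleAct_of]
      rw [simpleBasisAct, dif_pos ⟨⟨rfl, inferInstance⟩, s.deg_eq⟩]
    have := hassoc (Finsupp.single s r) s.obj
    rwa [(he _).2, hid] at this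

/-- The simple graded right `k C`-module `S_c`, concentrated in degree `0`: as a contravariant
representation of `C` it is `k` on the objects isomorphic to `c` and zero on the others,
isomorphisms between objects isomorphic to `c` act as the identity of `k`, and all other morphisms
act by zero. -/
def simple (k : Type w) [Field k] (hl : l.IsIndiscretelyBased) (c : C) : GrMod.{w, v, u} k l where
  piece j := SimpleIdx c j →₀ k
  act {i d j} _ := (simpleAct k c i j).compl₂ (CatAlg.homog k l d).subtype
  act_act h h' _ x a b := simpleAct_assoc hl c h h' x a.2 b.2
  act_unit {e} he {i} _ x := simpleAct_unit c x e.1 he fun y z =>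
    simpleAct_assoc hl c (d := 0) (e := 0) (by simp) (by simp) y
      (by simpa only [l.deg_id] using CatAlg.of_mem_homog (k := k) l ⟨z, z, 𝟙 z⟩) e.2

end GrMod

/-! ### Reduced cohomology of semi-simplicial sets -/

/-- A semi-simplicial set. -/
abbrev SemiSSet := SemiSimplexCategoryᵒᵖ ⥤ Type u

namespace SemiSSet

/-- The injective monotone map `[n] → [n + 1]` whose image omits `i`. -/
def coface (n : ℕ) (i : Fin (n + 2)) : SemiSimplexCategory.mk n ⟶ SemiSimplexCategory.mk (n + 1) :=
  SemiSimplexCategory.homEquiv.symm (Fin.succAboveOrderEmb i)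

theorem coface_comp (n : ℕ) {i j : Fin (n + 2)} (h : i ≤ j) :
    coface n i ≫ coface (n + 1) j.succ = coface n j ≫ coface (n + 1) i.castSucc := by
  have := SimplexCategory.δ_comp_δ h
  apply SemiSimplexCategory.toSimplexCategory.map_injective
  rw [Functor.map_comp, Functor.map_comp]
  exact this

/-- The face operators `∂ᵢ : K_{n + 1} → K_n`. -/
def face (K : SemiSSet.{u}) (n : ℕ) (i : Fin (n + 2)) :
    K.obj (op (.mk (n + 1))) → K.obj (op (.mk n)) := K.map (coface n i).op

/-- The cells of dimension `m - 1` of the augmented semi-simplicial set, which has exactly one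
cell of dimension `-1`. -/
def AugCell (K : SemiSSet.{u}) : ℕ → Type u
  | 0 => PUnit
  | m + 1 => K.obj (op (.mk m))

/-- The face operators of the augmented semi-simplicial set. -/
def augFace (K : SemiSSet.{u}) : ∀ m : ℕ, Fin (m + 1) → K.AugCell (m + 1) → K.AugCell m
  | 0 => fun _ _ => PUnit.unit
  | m + 1 => fun i x => K.face m i x

theorem augFace_augFace (K : SemiSSet.{u}) (m : ℕ) {i j : Fin (m + 1)} (h : i ≤ j)
    (x : K.AugCell (m + 2)) :
    K.augFace m i (K.augFace (m + 1) j.succ x) = K.augFace m j (K.augFace (m + 1) i.castSucc x) := by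
  cases m with
  | zero => rfl
  | succ m =>
    have := congrArg (fun q => K.map q.op) (coface_comp m h)
    rw [op_comp, op_comp, K.map_comp, K.map_comp] at this
    exact ConcreteCategory.congr_hom this x

/-- The differential of the augmented cochain complex:
`(dφ)(x) = ∑ᵢ (-1)ⁱ φ(∂ᵢ x)`. -/
def augD (k : Type w) [Field k] (K : SemiSSet.{u}) (m : ℕ) :
    (K.AugCell m → k) →ₗ[k] (K.AugCell (m + 1) → k) :=
  ∑ i : Fin (m + 1), (-1 : k) ^ (i : ℕ) • LinearMap.funLeft k k (K.augFace m i)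

theorem augD_apply (k : Type w) [Field k] (K : SemiSSet.{u}) (m : ℕ) (φ : K.AugCell m → k)
    (x : K.AugCell (m + 1)) :
    augD k K m φ x = ∑ i : Fin (m + 1), (-1 : k) ^ (i : ℕ) * φ (K.augFace m i x) := by
  simp [augD, LinearMap.funLeft_apply]

theorem augD_augD (k : Type w) [Field k] (K : SemiSSet.{u}) (m : ℕ) :
    (augD k K (m + 1)).comp (augD k K m) = 0 := by
  refine LinearMap.ext fun φ => funext fun x => ?_
  rw [LinearMap.comp_apply, augD_apply]
  simp only [augD_apply, Finset.mul_sum, LinearMap.zero_apply, Pi.zero_apply]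
  rw [← Finset.sum_product' Finset.univ Finset.univ
    (fun (j : Fin (m + 2)) (i : Fin (m + 1)) =>
      (-1 : k) ^ (j : ℕ) * ((-1 : k) ^ (i : ℕ) * φ (K.augFace m i (K.augFace (m + 1) j x))))]
  let S : Finset (Fin (m + 2) × Fin (m + 1)) := {q | (q.1 : ℕ) ≤ (q.2 : ℕ)}
  rw [Finset.univ_product_univ, ← Finset.sum_add_sum_compl S, ← eq_neg_iff_add_eq_zero,
    ← Finset.sum_neg_distrib]
  have hS : ∀ q, q ∈ S ↔ (q.1 : ℕ) ≤ (q.2 : ℕ) := fun q => by simp [S]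
  refine Finset.sum_bij' (fun q hq => (q.2.succ, q.1.castLT (((hS q).1 hq).trans_lt q.2.2)))
    (fun q hq => (q.2.castSucc, q.1.pred (by
      rintro h
      rw [Finset.mem_compl, hS, h] at hq
      exact hq (Nat.zero_le _)))) ?_ ?_ ?_ ?_ ?_
  · intro q hq
    rw [hS] at hq
    rw [Finset.mem_compl, hS]
    simp only [Fin.val_succ, Fin.val_castLT]
    omega
  · intro q hq
    rw [Finset.mem_compl, hS] at hq
    rw [hS]
    simp only [Fin.val_castSucc, Fin.val_pred]
    omega
  · intro q hq
    simp
  · intro q hq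
    simp
  · rintro ⟨j, i⟩ hq
    rw [hS] at hq
    have h := K.augFace_augFace m (i := j.castLT (hq.trans_lt i.2)) (j := i) hq x
    rw [Fin.castSucc_castLT] at h
    simp only [h, Fin.val_succ, Fin.val_castLT, pow_succ]
    ring

/-- The augmented cochain complex with coefficients in `k`, in which the functions on the cells of
dimension `m - 1` are placed in degree `m`. -/
def augComplex (k : Type w) [Field k] (K : SemiSSet.{u}) :
    CochainComplex (ModuleCat.{max u w} k) ℕ :=
  CochainComplex.of (fun m => ModuleCat.of k (K.AugCell m → k))
    (fun m => ModuleCat.ofHom (augD k K m))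
    (fun m => by rw [← ModuleCat.ofHom_comp, augD_augD]; rfl)

/-- The reduced cohomology `H̃ʲ` with coefficients in `k` of the geometric realization of a
semi-simplicial set, computed by the augmented cellular cochain complex, with the functions on the
cells of dimension `m` in degree `m ≥ -1`. -/
def redCohomology (k : Type w) [Field k] (K : SemiSSet.{u}) (j : ℤ) :
    ModuleCat.{max u w} k :=
  ((augComplex k K).extend (ComplexShape.embeddingUpIntGE (-1))).homology j

end SemiSSet

/-! ### The semi-simplicial set of nontrivial factorizations -/

section Factorization

variable {C : Type u} [Category.{v} C] {a b : C}

/-- A factorization `p = f₀ ∘ f₁ ∘ ⋯ ∘ f_{n + 1}` of a morphism `p : a → b`, written as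
`a → X_n → ⋯ → X₁ → X₀ → b`. It is encoded as the chain `X_n → ⋯ → X₀` of objects equipped with
morphisms from `a` and to `b` that compose to `p`. -/
abbrev FactChain (p : a ⟶ b) (n : ℕ) := (Fin (n + 1))ᵒᵖ ⥤ Factorisation p

/-- The factorization is nontrivial: none of its `n + 2` factors is an isomorphism. -/
structure FactChain.IsNontrivial {p : a ⟶ b} {n : ℕ} (F : FactChain p n) : Prop where
  /-- the factor `f₀ : X₀ → b` -/
  first : ¬ IsIso (F.obj (op 0)).π
  /-- the factors `f_{i + 1} : X_{i + 1} → X_i` -/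
  middle : ∀ i : Fin n, ¬ IsIso (F.map (homOfLE (Fin.castSucc_lt_succ (i := i)).le).op).h
  /-- the factor `f_{n + 1} : a → X_n` -/
  last : ¬ IsIso (F.obj (op (Fin.last n))).ι

/-- Nontrivial factorizations of `p` into `n + 2` factors. -/
def NontrivFact (p : a ⟶ b) (n : ℕ) := {F : FactChain p n // F.IsNontrivial}

/-- Two factorizations are equivalent if they differ by isomorphisms of the intermediate objects:
`f'₀ = f₀ ∘ h₀`, `f'ᵢ = hᵢ₋₁⁻¹ ∘ fᵢ ∘ hᵢ` and `f'_{n + 1} = hₙ⁻¹ ∘ f_{n + 1}`. -/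
instance NontrivFact.setoid (p : a ⟶ b) (n : ℕ) : Setoid (NontrivFact p n) where
  r F G := Nonempty (F.1 ≅ G.1)
  iseqv := ⟨fun _ => ⟨Iso.refl _⟩, fun ⟨e⟩ => ⟨e.symm⟩, fun ⟨e⟩ ⟨e'⟩ => ⟨e ≪≫ e'⟩⟩

namespace NontrivFact

variable {l : CatGrading C}

theorem deg_pos_map (hl : l.IsIndiscretelyBased) {p : a ⟶ b} {n : ℕ} {F : FactChain p n}
    (hF : F.IsNontrivial) {i j : Fin (n + 1)} (h : i < j) :
    0 < l.deg (F.map (homOfLE h.le).op).h := by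
  have hi : (i : ℕ) < n := by omega
  let t : Fin n := ⟨i, hi⟩
  have h1 : i = t.castSucc := rfl
  have h2 : t.succ ≤ j := by
    rw [Fin.le_def]
    exact h
  have e : F.map (homOfLE h.le).op =
      F.map (homOfLE h2).op ≫ F.map (homOfLE (Fin.castSucc_lt_succ (i := t)).le).op := by
    rw [← F.map_comp]
    rfl
  have h3 := hF.middle t
  rw [hl.isIso_iff] at h3
  rw [e, Factorisation.comp_h, l.deg_comp]
  omega

theorem deg_pos_π (hl : l.IsIndiscretelyBased) {p : a ⟶ b} {n : ℕ} {F : FactChain p n}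
    (hF : F.IsNontrivial) (i : Fin (n + 1)) : 0 < l.deg (F.obj (op i)).π := by
  have h3 := hF.first
  rw [hl.isIso_iff] at h3
  rw [← (F.map (homOfLE (Fin.zero_le i)).op).h_π, l.deg_comp]
  omega

theorem deg_pos_ι (hl : l.IsIndiscretelyBased) {p : a ⟶ b} {n : ℕ} {F : FactChain p n}
    (hF : F.IsNontrivial) (i : Fin (n + 1)) : 0 < l.deg (F.obj (op i)).ι := by
  have h3 := hF.last
  rw [hl.isIso_iff] at h3
  rw [← (F.map (homOfLE (Fin.le_last i)).op).ι_h, l.deg_comp]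
  omega

/-- Composing adjacent factors: the restriction of a factorization along an injective monotone map
`[m] → [n]` of the indices of the intermediate objects. For the map that omits `i` this is
`(f₀, …, f_{n + 1}) ↦ (f₀, …, fᵢ ∘ f_{i + 1}, …, f_{n + 1})`. -/
def restrict (hl : l.IsIndiscretelyBased) (p : a ⟶ b) {m n : ℕ} (α : Fin (m + 1) ↪o Fin (n + 1))
    (F : NontrivFact p n) : NontrivFact p m :=
  ⟨α.monotone.functor.op ⋙ F.1,
    { first := by
        rw [hl.isIso_iff]
        exact (deg_pos_π hl F.2 _).ne'
      middle := fun i => by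
        rw [hl.isIso_iff]
        exact (deg_pos_map hl F.2 (α.strictMono (Fin.castSucc_lt_succ (i := i)))).ne'
      last := by
        rw [hl.isIso_iff]
        exact (deg_pos_ι hl F.2 _).ne' }⟩

end NontrivFact

/-- The semi-simplicial set `C(p)` of nontrivial factorizations of a morphism `p`: its `n`-cells
are the equivalence classes of nontrivial factorizations `p = f₀ ∘ ⋯ ∘ f_{n + 1}`, and its face
operators compose adjacent factors. -/
def factSSet {l : CatGrading C} (hl : l.IsIndiscretelyBased) (p : a ⟶ b) :
    SemiSSet.{max u v} where
  obj n := Quotient (NontrivFact.setoid p n.unop.len)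
  map α := TypeCat.ofHom (Quotient.map
    (NontrivFact.restrict hl p (SemiSimplexCategory.homEquiv α.unop))
    fun _ _ ⟨e⟩ => ⟨Functor.isoWhiskerLeft _ e⟩)
  map_id n := by
    ext x
    obtain ⟨x, rfl⟩ := Quotient.exists_rep x
    rfl
  map_comp α β := by
    ext x
    obtain ⟨x, rfl⟩ := Quotient.exists_rep x
    simp only [unop_comp, SemiSimplexCategory.homEquiv_comp]
    rfl

end Factorization
end

/-!
The extensions of `S_w` by a shift of `S_v` are computed with a reduced bar resolution of `S_w`.
Choose a representative of each isomorphism class of objects. In homological degree `r` the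
resolution is the free graded module on the chains `z → ⋯ → w` of `r` morphisms of positive length
between representatives (`BarChain`), and the differential (`GrMod.barD`) multiplies the chain
without its first morphism by that morphism, plus the alternating sum of the inner faces, which
compose two adjacent morphisms. Because `C` is indiscretely based, a morphism of length zero is an
isomorphism and is determined by its source and its target. Hence every morphism of positive length
factors uniquely as the chosen isomorphism from its source to the representative followed by a
morphism out of the representative, and splitting it in this way is a contracting homotopy
(`GrMod.barD_barH_add`, `GrMod.barD_barH_add_barAug`); both exactness and the vanishing of the
square of the differential follow from it.

A homomorphism from a free module to `S_v(-n)` is an arbitrary family of scalars on the generators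
of degree `n` at objects isomorphic to `v` (`GrMod.freeHomCoord`). Taking `v` as its own
representative, the homomorphisms from the term in homological degree `m + 1` are the functions on
the chains of `m + 1` morphisms from `v` to `w` of total length `n`. For `n ≠ 0` these chains are
grouped by their composite `p`. Over a fixed `p` they are in bijection with the cells of dimension
`m - 1` of the augmented semi-simplicial set of nontrivial factorizations of `p`
(`BarChain.cell_injective`, `BarChain.exists_cell_eq`): up to isomorphism, the intermediate objects
of a factorization can be replaced by the chosen representatives, in exactly one way. The inner
faces of chains are the faces of cells in the reverse order (`BarChain.augFace_cell`), and the
remaining term of the differential does not contribute, since morphisms of positive length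
annihilate `S_v`. So the complex of homomorphisms is, up to signs and a shift of the degree by two,
the product of the augmented cochain complexes of these semi-simplicial sets
(`GrMod.cochain_bijective`, `GrMod.cochain_barD`), apart from the homomorphisms from the term in
homological degree zero, which vanish for `n ≠ 0`. Since products of vector spaces are exact, the
extensions are the product of the reduced cohomology spaces. For `n = 0` only the empty chain has
the right length, and only the homomorphisms from the term in homological degree zero remain.
-/

noncomputable section

/-! ### Graded modules as representations -/

namespace GrMod

variable {k : Type w} [Field k] {C : Type u} [Category.{v} C] {l : CatGrading C}

/-- Right multiplication by a morphism of `C`. -/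
def rmul (M : GrMod.{w, v, u} k l) {x y : C} (f : x ⟶ y) {i j : ℤ} (h : i + l.deg f = j) :
    M.piece i →ₗ[k] M.piece j :=
  (M.act h).flip ⟨CatAlg.of k ⟨x, y, f⟩, CatAlg.of_mem_homog l ⟨x, y, f⟩⟩

theorem act_congr (M : GrMod.{w, v, u} k l) {i j : ℤ} {d d' : ℕ} (h : i + d = j) (h' : i + d' = j)
    (x : M.piece i) (a : CatAlg.homog k l d) (b : CatAlg.homog k l d') (hab : a.1 = b.1) :
    M.act h x a = M.act h' x b := by
  obtain rfl : d = d' := by omega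
  obtain rfl : a = b := Subtype.ext hab
  rfl

theorem rmul_rmul (M : GrMod.{w, v, u} k l) {x y z : C} (f : y ⟶ z) (g : x ⟶ y) {i j m : ℤ}
    (h : i + l.deg f = j) (h' : j + l.deg g = m) (a : M.piece i) :
    M.rmul g h' (M.rmul f h a) =
      M.rmul (g ≫ f) (by rw [l.deg_comp]; push_cast; omega) a := by
  refine (M.act_act h h' (by push_cast; omega) a _ _).trans (M.act_congr _ _ _ _ _ ?_)
  simp only [CatAlg.of_mul_of, CatAlg.mulBasis, dif_pos, eqToHom_refl, Category.id_comp]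

theorem rmul_rmul_of_ne (M : GrMod.{w, v, u} k l) {x y y' z : C} (f : y ⟶ z) (g : x ⟶ y')
    (hy : y' ≠ y) {i j m : ℤ} (h : i + l.deg f = j) (h' : j + l.deg g = m) (a : M.piece i) :
    M.rmul g h' (M.rmul f h a) = 0 := by
  refine (M.act_act h h' (by push_cast; omega) a _ _).trans ?_
  have h'' : i + ((l.deg f + l.deg g : ℕ) : ℤ) = m := by push_cast; omega
  refine (M.act_congr _ h'' _ _ 0 ?_).trans (map_zero _)
  exact (CatAlg.of_mul_of _ _).trans (dif_neg hy)

theorem Hom.app_rmul {M N : GrMod.{w, v, u} k l} (φ : M ⟶ N) {x y : C} (f : x ⟶ y) {i j : ℤ}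
    (h : i + l.deg f = j) (a : M.piece i) :
    φ.app j (M.rmul f h a) = N.rmul f h (φ.app i a) :=
  φ.app_act h a _

/-- A family of linear maps that commutes with the action of the morphisms of `C` is a
homomorphism. -/
def homMk {M N : GrMod.{w, v, u} k l} (app : ∀ i, M.piece i →ₗ[k] N.piece i)
    (hf : ∀ {x y : C} (f : x ⟶ y) {i j : ℤ} (h : i + l.deg f = j) (a : M.piece i),
      app j (M.rmul f h a) = N.rmul f h (app i a)) : M ⟶ N where
  app := app
  app_act {i d j} h x a := by
    obtain ⟨a, ha⟩ := a
    induction ha using Submodule.span_induction with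
    | zero =>
      have : (⟨0, zero_mem _⟩ : CatAlg.homog k l d) = 0 := rfl
      rw [this]
      simp
    | add a b ha hb iha ihb =>
      have : (⟨a + b, add_mem ha hb⟩ : CatAlg.homog k l d) = ⟨a, ha⟩ + ⟨b, hb⟩ := rfl
      rw [this]
      simp [iha, ihb]
    | smul r a ha iha =>
      have : (⟨r • a, Submodule.smul_mem _ r ha⟩ : CatAlg.homog k l d) = r • ⟨a, ha⟩ := rfl
      rw [this]
      simp [iha]
    | mem a ha =>
      obtain ⟨f, rfl, rfl⟩ := ha
      exact hf f.hom h x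

/-- A sequence of graded modules is exact if it is exact in each degree. -/
theorem exact_of_forall {S : ShortComplex (GrMod.{w, v, u} k l)}
    (h : ∀ (i : ℤ) (x : S.X₂.piece i), S.g.app i x = 0 → ∃ y, S.f.app i y = x) : S.Exact := by
  rw [S.exact_iff_of_forks (kerIsLimit S.g) (cokerIsColimit S.f)]
  ext i x
  obtain ⟨y, hy⟩ := h i x.1 x.2
  exact (Submodule.Quotient.mk_eq_zero _).2 ⟨y, hy⟩

/-! ### Free graded modules -/

section Free

variable {T : Type (max u v)} (c : T → C) (d : T → ℤ)

/-- The basis of the degree `j` component of the free graded module on generators `t : T` of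
degree `d t` at the object `c t`: the products of a generator `t` with a morphism into `c t`. -/
structure FreeIdx (l : CatGrading C) (c : T → C) (d : T → ℤ) (j : ℤ) : Type (max u v) where
  /-- the generator -/
  gen : T
  /-- the source of the morphism -/
  src : C
  /-- the morphism -/
  hom : src ⟶ c gen
  deg_eq : d gen + l.deg hom = j

variable {c d}

open Classical in
/-- The action of a morphism on a basis vector of the free graded module. -/
def freeBasisAct (k : Type w) [Field k] {i : ℤ} (j : ℤ) (b : FreeIdx l c d i) (a : CatMor C) :
    FreeIdx l c d j →₀ k :=
  if h : ∃ h : a.tgt = b.src, d b.gen + l.deg (a.hom ≫ eqToHom h ≫ b.hom) = j then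
    Finsupp.single ⟨b.gen, a.src, a.hom ≫ eqToHom h.1 ≫ b.hom, h.2⟩ 1
  else 0

/-- The bilinear extension of the action on basis vectors. -/
def freeAct (k : Type w) [Field k] (l : CatGrading C) (c : T → C) (d : T → ℤ) (i j : ℤ) :
    (FreeIdx l c d i →₀ k) →ₗ[k] CatAlg k C →ₗ[k] (FreeIdx l c d j →₀ k) :=
  Finsupp.linearCombination k fun s => CatAlg.lin fun a => freeBasisAct k j s a

theorem freeAct_of {i : ℤ} (j : ℤ) (s : FreeIdx l c d i) (r : k) (a : CatMor C) :
    freeAct k l c d i j (Finsupp.single s r) (CatAlg.of k a) = r • freeBasisAct k j s a := by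
  rw [freeAct, Finsupp.linearCombination_single, LinearMap.smul_apply, CatAlg.lin_of]

theorem freeAct_of_eq {i : ℤ} (j : ℤ) (t : T) {x y : C} (g : y ⟶ c t) (f : x ⟶ y)
    (hg : d t + l.deg g = i) (h : i + l.deg f = j) (r : k) :
    freeAct k l c d i j (Finsupp.single ⟨t, y, g, hg⟩ r) (CatAlg.of k ⟨x, y, f⟩) =
      Finsupp.single ⟨t, x, f ≫ g, by rw [l.deg_comp]; push_cast; omega⟩ r := by
  have h' : ∃ h : y = y, d t + l.deg (f ≫ eqToHom h ≫ g) = j :=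
    ⟨rfl, by simp only [eqToHom_refl, Category.id_comp, l.deg_comp]; push_cast; omega⟩
  rw [freeAct_of, freeBasisAct, dif_pos h']
  simp

theorem freeAct_of_ne {i : ℤ} (j : ℤ) (b : FreeIdx l c d i) (a : CatMor C) (h : a.tgt ≠ b.src)
    (r : k) : freeAct k l c d i j (Finsupp.single b r) (CatAlg.of k a) = 0 := by
  rw [freeAct_of, freeBasisAct, dif_neg (fun q => h q.1), smul_zero]

theorem freeAct_assoc {i : ℤ} {p : ℕ} {j : ℤ} {e : ℕ} {m : ℤ} (h : i + p = j) (h' : j + e = m)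
    (x : FreeIdx l c d i →₀ k) {a b : CatAlg k C}
    (ha : a ∈ CatAlg.homog k l p) (hb : b ∈ CatAlg.homog k l e) :
    freeAct k l c d j m (freeAct k l c d i j x a) b = freeAct k l c d i m x (a * b) := by
  induction ha using Submodule.span_induction with
  | zero => simp
  | add x y _ _ hx hy => simp [add_mul, hx, hy]
  | smul r x _ hx => simp [smul_mul_assoc, hx]
  | mem y hy =>
    obtain ⟨⟨a0, a1, a⟩, rfl, rfl⟩ := hy
    induction hb using Submodule.span_induction with
    | zero => simp
    | add x y _ _ hx hy => simp [mul_add, hx, hy]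
    | smul r x _ hx => simp [mul_smul_comm, hx]
    | mem y hy =>
      obtain ⟨⟨b0, b1, b⟩, rfl, rfl⟩ := hy
      induction x using Finsupp.induction_linear with
      | zero => simp
      | add x y hx hy => simp [hx, hy]
      | single s r =>
        obtain ⟨t, y, g, hg⟩ := s
        dsimp only at h h'
        rw [CatAlg.of_mul_of]
        by_cases hab : b1 = a0
        · subst hab
          simp only [CatAlg.mulBasis, dif_pos, eqToHom_refl, Category.id_comp]
          by_cases hay : a1 = y
          · subst hay
            rw [freeAct_of_eq _ _ _ _ _ h, freeAct_of_eq _ _ _ _ _ h', freeAct_of_eq]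
            · simp only [Category.assoc]
            · rw [l.deg_comp]; push_cast; omega
          · rw [freeAct_of_ne _ _ _ hay, freeAct_of_ne _ _ _ hay, map_zero, LinearMap.zero_apply]
        · simp only [CatAlg.mulBasis, dif_neg hab, map_zero]
          by_cases hay : a1 = y
          · subst hay
            rw [freeAct_of_eq _ _ _ _ _ h, freeAct_of_ne _ _ _ hab]
          · rw [freeAct_of_ne _ _ _ hay, map_zero, LinearMap.zero_apply]

/-- The unit of `k C`, if there is one, acts as the identity: compare its action with that of the
identity of the source of a basis vector. -/
theorem freeAct_unit {i : ℤ} (x : FreeIdx l c d i →₀ k) {e : CatAlg k C}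
    (hmem : e ∈ CatAlg.homog k l 0) (he : ∀ a : CatAlg k C, e * a = a ∧ a * e = a) :
    freeAct k l c d i i x e = x := by
  induction x using Finsupp.induction_linear with
  | zero => simp
  | add x y hx hy => simp [hx, hy]
  | single s r =>
    obtain ⟨t, y, g, hg⟩ := s
    have hid := freeAct_of_eq i t g (𝟙 y) hg (by simp [l.deg_id]) r
    have := freeAct_assoc (p := 0) (e := 0) (i := i) (j := i) (m := i) (by simp) (by simp)
      (Finsupp.single ⟨t, y, g, hg⟩ r) (a := CatAlg.of k ⟨y, y, 𝟙 y⟩) (b := e)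
      (by simpa only [l.deg_id] using CatAlg.of_mem_homog (k := k) l ⟨y, y, 𝟙 y⟩) hmem
    rw [(he _).2, hid] at this
    simpa only [Category.id_comp] using this

/-- The free graded right `k C`-module on generators `t : T` of degree `d t` at the object `c t`,
that is, `⨁ₜ e_{c t} k C (- d t)`. -/
def freeMod (k : Type w) [Field k] (l : CatGrading C) (c : T → C) (d : T → ℤ) :
    GrMod.{w, v, u} k l where
  piece j := FreeIdx l c d j →₀ k
  act {i p j} _ := (freeAct k l c d i j).compl₂ (CatAlg.homog k l p).subtype
  act_act h h' _ x a b := freeAct_assoc h h' x a.2 b.2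
  act_unit e he _ _ x := freeAct_unit x e.2 he

/-- The product of the generator `t` with the morphism `g` into the object of `t`. -/
def freeBas (k : Type w) [Field k] (l : CatGrading C) (c : T → C) (d : T → ℤ) (t : T) {x : C}
    (g : x ⟶ c t) {j : ℤ} (h : d t + l.deg g = j) : (freeMod k l c d).piece j :=
  (Finsupp.single ⟨t, x, g, h⟩ 1 : FreeIdx l c d j →₀ k)

theorem rmul_freeBas (t : T) {x y : C} (g : y ⟶ c t) (f : x ⟶ y) {i j : ℤ}
    (hg : d t + l.deg g = i) (h : i + l.deg f = j) :
    (freeMod k l c d).rmul f h (freeBas k l c d t g hg) =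
      freeBas k l c d t (f ≫ g) (by rw [l.deg_comp]; push_cast; omega) :=
  freeAct_of_eq j t g f hg h 1

theorem freeBas_eq_rmul (t : T) {x : C} (g : x ⟶ c t) {j : ℤ} (h : d t + l.deg g = j) :
    freeBas k l c d t g h = (freeMod k l c d).rmul g h
      (freeBas k l c d t (𝟙 _) (by simp [l.deg_id])) := by
  rw [rmul_freeBas]
  simp only [Category.comp_id]

/-- Linear maps on a component of a free graded module are determined by their values on the
basis. -/
theorem free_lhom_ext {V : Type*} [AddCommGroup V] [Module k V] {j : ℤ}
    {φ ψ : (freeMod k l c d).piece j →ₗ[k] V}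
    (h : ∀ (t : T) (x : C) (g : x ⟶ c t) (hg : d t + l.deg g = j),
      φ (freeBas k l c d t g hg) = ψ (freeBas k l c d t g hg)) : φ = ψ :=
  Finsupp.lhom_ext' fun ⟨t, x, g, hg⟩ => LinearMap.ext_ring (h t x g hg)

/-- The linear map on a component of a free graded module with prescribed values on the basis. -/
def freeLin {V : Type*} [AddCommGroup V] [Module k V] {j : ℤ}
    (φ : ∀ (t : T) (x : C) (g : x ⟶ c t), d t + l.deg g = j → V) :
    (freeMod k l c d).piece j →ₗ[k] V :=
  Finsupp.linearCombination k fun b : FreeIdx l c d j => φ b.gen b.src b.hom b.deg_eq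

@[simp] theorem freeLin_freeBas {V : Type*} [AddCommGroup V] [Module k V] {j : ℤ}
    (φ : ∀ (t : T) (x : C) (g : x ⟶ c t), d t + l.deg g = j → V) (t : T) {x : C} (g : x ⟶ c t)
    (h : d t + l.deg g = j) : freeLin φ (freeBas k l c d t g h) = φ t x g h :=
  (Finsupp.linearCombination_single k (1 : k) _).trans (one_smul k _)

theorem free_hom_ext {N : GrMod.{w, v, u} k l} {φ ψ : freeMod k l c d ⟶ N}
    (h : ∀ t, φ.app (d t) (freeBas k l c d t (𝟙 _) (by simp [l.deg_id])) =
      ψ.app (d t) (freeBas k l c d t (𝟙 _) (by simp [l.deg_id]))) : φ = ψ := by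
  refine Hom.ext (funext fun j => free_lhom_ext fun t x g hg => ?_)
  rw [freeBas_eq_rmul, Hom.app_rmul, Hom.app_rmul, h]

/-- The homomorphism out of a free graded module that sends each generator `t` to
`a t · e_{c t}`. -/
def freeLift {N : GrMod.{w, v, u} k l} (a : ∀ t, N.piece (d t)) : freeMod k l c d ⟶ N :=
  homMk (fun _ => freeLin fun t _ g hg => N.rmul g hg (a t)) (by
    intro x y f i j h b
    refine LinearMap.congr_fun (f := (freeLin fun t _ g hg => N.rmul g hg (a t)).comp
      ((freeMod k l c d).rmul f h)) (g := (N.rmul f h).comp _) (free_lhom_ext ?_) b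
    intro t z g hg
    -- Both sides vanish unless the target of `f` is the source of `g`.
    by_cases hz : y = z
    · subst hz
      rw [LinearMap.comp_apply, LinearMap.comp_apply, rmul_freeBas, freeLin_freeBas,
        freeLin_freeBas, rmul_rmul]
    · rw [LinearMap.comp_apply, LinearMap.comp_apply, freeLin_freeBas, rmul_rmul_of_ne _ _ _ hz,
        freeBas_eq_rmul, rmul_rmul_of_ne _ _ _ hz, map_zero])

theorem freeLift_freeBas {N : GrMod.{w, v, u} k l} (a : ∀ t, N.piece (d t)) (t : T) {x : C}
    (g : x ⟶ c t) {j : ℤ} (h : d t + l.deg g = j) :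
    (freeLift a : freeMod k l c d ⟶ N).app j (freeBas k l c d t g h) = N.rmul g h (a t) :=
  freeLin_freeBas _ _ _ _

/-- Free graded modules are projective, since homomorphisms out of them are given by their values on
the generators and epimorphisms are surjective in each degree. -/
instance projective_freeMod : Projective (freeMod k l c d) where
  factors {E X} f e _ := by
    choose a ha using fun t => surjective_of_epi e (d t)
      (f.app (d t) (freeBas k l c d t (𝟙 _) (by simp [l.deg_id])))
    refine ⟨freeLift a, free_hom_ext fun t => ?_⟩
    rw [comp_app, freeLift_freeBas, Hom.app_rmul, ha, ← Hom.app_rmul, ← freeBas_eq_rmul]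

end Free

end GrMod

/-! ### Reduced chains of non-isomorphisms -/

/-- A choice of a representative of each isomorphism class of objects, together with an isomorphism
from each object to its representative. -/
structure ObjReps (C : Type u) [Category.{v} C] where
  /-- the representative -/
  rep : C → C
  /-- the chosen isomorphism -/
  iso : ∀ x, x ≅ rep x
  rep_eq : ∀ {x y : C}, (x ≅ y) → rep x = rep y

theorem ObjReps.rep_rep {C : Type u} [Category.{v} C] (R : ObjReps C) (x : C) :
    R.rep (R.rep x) = R.rep x :=
  (R.rep_eq (R.iso x)).symm

/-- Representatives can be chosen such that a given object represents its class. -/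
theorem ObjReps.exists_rep_eq {C : Type u} [Category.{v} C] (x : C) :
    ∃ R : ObjReps C, R.rep x = x := by
  classical
  let := isIsomorphicSetoid C
  have hs : ∀ y : C, Nonempty (y ≅ Quotient.out (Quotient.mk (isIsomorphicSetoid C) y)) := fun y =>
    Setoid.symm (Quotient.mk_out y)
  refine ⟨⟨fun y => if Nonempty (y ≅ x) then x
    else Quotient.out (Quotient.mk (isIsomorphicSetoid C) y), fun y => ?_, fun {y z} e => ?_⟩, ?_⟩
  · by_cases h : Nonempty (y ≅ x)
    · exact h.some ≪≫ eqToIso (if_pos h).symm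
    · exact (hs y).some ≪≫ eqToIso (if_neg h).symm
  · have h1 : Nonempty (y ≅ x) ↔ Nonempty (z ≅ x) :=
      ⟨fun ⟨q⟩ => ⟨e.symm ≪≫ q⟩, fun ⟨q⟩ => ⟨e ≪≫ q⟩⟩
    have h2 : Quotient.mk (isIsomorphicSetoid C) y = Quotient.mk (isIsomorphicSetoid C) z :=
      Quotient.sound ⟨e⟩
    rw [h2]
    simp only [h1]
  · exact if_pos ⟨Iso.refl x⟩

namespace CatGrading

variable {C : Type u} [Category.{v} C] {l : CatGrading C}

/-- In an indiscretely based category, parallel isomorphisms are equal. -/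
theorem IsIndiscretelyBased.hom_eq (hl : l.IsIndiscretelyBased) {x y : C} {f g : x ⟶ y}
    (hf : l.deg f = 0) (hg : l.deg g = 0) : f = g := by
  let F : (⟨x⟩ : l.ZeroPart) ⟶ ⟨y⟩ := ⟨f, hf⟩
  let G : (⟨x⟩ : l.ZeroPart) ⟶ ⟨y⟩ := ⟨g, hg⟩
  obtain ⟨U⟩ := hl _ _ (Zigzag.of_hom F)
  exact congrArg InducedWideCategory.Hom.hom (Subsingleton.elim F G)

end CatGrading

/-- A chain `z → ⋯ → w` of `r` morphisms of positive length in which all objects except possibly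
`w` are the chosen representatives of their isomorphism classes. -/
inductive BarChain {C : Type u} [Category.{v} C] (l : CatGrading C) (R : ObjReps C) (w : C) :
    ℕ → C → Type (max u v)
  | nil : BarChain l R w 0 w
  | cons {r : ℕ} {y z : C} (s : BarChain l R w r y) (hz : R.rep z = z) (f : z ⟶ y)
      (hf : 0 < l.deg f) : BarChain l R w (r + 1) z

namespace BarChain

variable {C : Type u} [Category.{v} C] {l : CatGrading C} {R : ObjReps C} {w : C}

/-- The composite of a chain. -/
def comp : ∀ {r : ℕ} {z : C}, BarChain l R w r z → (z ⟶ w)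
  | _, _, nil => 𝟙 w
  | _, _, cons s _ f _ => f ≫ s.comp

@[simp] theorem comp_nil : (nil : BarChain l R w 0 w).comp = 𝟙 w := rfl

@[simp] theorem comp_cons {r : ℕ} {y z : C} (s : BarChain l R w r y) (hz : R.rep z = z)
    (f : z ⟶ y) (hf : 0 < l.deg f) : (cons s hz f hf).comp = f ≫ s.comp := rfl

theorem rep_eq : ∀ {r : ℕ} {z : C}, BarChain l R w (r + 1) z → R.rep z = z
  | _, _, cons _ hz _ _ => hz

theorem deg_comp_pos {r : ℕ} {z : C} (s : BarChain l R w (r + 1) z) : 0 < l.deg s.comp := by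
  cases s with
  | cons s hz f hf =>
    rw [comp_cons, l.deg_comp]
    omega

/-- The chain obtained by composing a morphism with the first morphism of a chain. -/
def precomp : ∀ {r : ℕ} {y z : C}, BarChain l R w (r + 1) y → R.rep z = z → (z ⟶ y) →
    BarChain l R w (r + 1) z
  | _, _, _, cons s _ g hg, hz, f => cons s hz (f ≫ g) (by rw [l.deg_comp]; omega)

@[simp] theorem precomp_cons {r : ℕ} {x y z : C} (s : BarChain l R w r x) (hy : R.rep y = y)
    (g : y ⟶ x) (hg : 0 < l.deg g) (hz : R.rep z = z) (f : z ⟶ y) :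
    (cons s hy g hg).precomp hz f = cons s hz (f ≫ g) (by rw [l.deg_comp]; omega) := rfl

theorem comp_precomp {r : ℕ} {y z : C} (s : BarChain l R w (r + 1) y) (hz : R.rep z = z)
    (f : z ⟶ y) : (s.precomp hz f).comp = f ≫ s.comp := by
  cases s with
  | cons s hy g hg => simp

/-- The inner faces of a chain: the `i`-th face composes the morphisms number `i` and `i + 1`,
counted from the source. -/
def face : ∀ {r : ℕ} {z : C}, BarChain l R w (r + 1) z → Fin r → BarChain l R w r z
  | 0, _, _, i => i.elim0
  | _ + 1, _, cons s hz f hf, i => Fin.cases (s.precomp hz f) (fun i => cons (s.face i) hz f hf) i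

@[simp] theorem face_zero {r : ℕ} {y z : C} (s : BarChain l R w (r + 1) y) (hz : R.rep z = z)
    (f : z ⟶ y) (hf : 0 < l.deg f) : (cons s hz f hf).face 0 = s.precomp hz f := rfl

@[simp] theorem face_succ {r : ℕ} {y z : C} (s : BarChain l R w (r + 1) y) (hz : R.rep z = z)
    (f : z ⟶ y) (hf : 0 < l.deg f) (i : Fin r) :
    (cons s hz f hf).face i.succ = cons (s.face i) hz f hf := rfl

theorem comp_face : ∀ {r : ℕ} {z : C} (s : BarChain l R w (r + 1) z) (i : Fin r),
    (s.face i).comp = s.comp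
  | 0, _, _, i => i.elim0
  | r + 1, _, cons s hz f hf, i => by
    induction i using Fin.cases with
    | zero => rw [face_zero, comp_precomp, comp_cons]
    | succ i => rw [face_succ, comp_cons, comp_cons, comp_face s i]

end BarChain

/-! ### The reduced bar resolution -/

namespace GrMod

variable (k : Type w) [Field k] {C : Type u} [Category.{v} C] {l : CatGrading C} (R : ObjReps C)
  (w : C)

/-- The term in homological degree `r` of the reduced bar resolution: the free graded module on
the reduced chains of `r` morphisms that end at `w`. -/
abbrev barMod (l : CatGrading C) (r : ℕ) : GrMod.{w, v, u} k l :=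
  freeMod k l (T := Σ z, BarChain l R w r z) (fun t => t.1) (fun t => l.deg t.2.comp)

variable {R w}

/-- The product of a chain with a morphism into its source. -/
def bas {r : ℕ} {z : C} (s : BarChain l R w r z) {x : C} (g : x ⟶ z) {j : ℤ}
    (h : (l.deg s.comp : ℤ) + l.deg g = j) : (barMod k R w l r).piece j :=
  freeBas k l (T := Σ z, BarChain l R w r z) (fun t => t.1) (fun t => l.deg t.2.comp) ⟨z, s⟩ g h

variable {k}

theorem rmul_bas {r : ℕ} {z : C} (s : BarChain l R w r z) {x y : C} (g : y ⟶ z) (f : x ⟶ y)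
    {i j : ℤ} (hg : (l.deg s.comp : ℤ) + l.deg g = i) (h : i + l.deg f = j) :
    (barMod k R w l r).rmul f h (bas k s g hg) =
      bas k s (f ≫ g) (by rw [l.deg_comp]; push_cast; omega) :=
  rmul_freeBas _ _ _ _ _

theorem bas_congr {r : ℕ} {z : C} {s s' : BarChain l R w r z} {x : C} {g g' : x ⟶ z} {j : ℤ}
    (h : (l.deg s.comp : ℤ) + l.deg g = j) (hs : s = s') (hg : g = g') :
    bas k s g h = bas k s' g' (by rw [← hs, ← hg, h]) := by
  subst hs hg
  rfl

/-- The value of the differential of the bar resolution on the generator given by a chain. -/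
def barDGen : ∀ {r : ℕ} {z : C} (s : BarChain l R w (r + 1) z),
    (barMod k R w l r).piece (l.deg s.comp)
  | r, z, .cons s hz f hf => bas k s f (by rw [BarChain.comp_cons, l.deg_comp]; push_cast; omega) +
      ∑ i : Fin r, (-1 : k) ^ ((i : ℕ) + 1) •
        bas k ((BarChain.cons s hz f hf).face i) (𝟙 z) (by rw [BarChain.comp_face, l.deg_id]; simp)

variable (k R w l)

/-- The differential of the reduced bar resolution. -/
def barD (r : ℕ) : barMod k R w l (r + 1) ⟶ barMod k R w l r :=
  freeLift fun t => barDGen t.2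

variable {R w l k}

theorem barD_bas {r : ℕ} {y z : C} (s : BarChain l R w r y) (hz : R.rep z = z)
    (f : z ⟶ y) (hf : 0 < l.deg f) {x : C} (g : x ⟶ z) {j : ℤ}
    (h : (l.deg (BarChain.cons s hz f hf).comp : ℤ) + l.deg g = j) :
    (barD k l R w r).app j (bas k (BarChain.cons s hz f hf) g h) =
      bas k s (g ≫ f) (by
        rw [BarChain.comp_cons, l.deg_comp] at h; rw [l.deg_comp]; push_cast at h ⊢; omega) +
      ∑ i : Fin r, (-1 : k) ^ ((i : ℕ) + 1) •
        bas k ((BarChain.cons s hz f hf).face i) g (by rw [BarChain.comp_face, h]) := by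
  refine (freeLift_freeBas _ _ _ _).trans ?_
  simp only [barDGen, map_add, map_sum, map_smul, rmul_bas, Category.comp_id]

/-- The contracting homotopy of the reduced bar resolution: it appends the morphism by which a
chain is multiplied, unless it is an isomorphism, in which case the value is zero. -/
def barH (r : ℕ) (j : ℤ) : (barMod k R w l r).piece j →ₗ[k] (barMod k R w l (r + 1)).piece j :=
  freeLin fun t x g h => if hg : 0 < l.deg g then
    bas k (BarChain.cons t.2 (R.rep_rep x) ((R.iso x).inv ≫ g)
      (by rw [l.deg_comp]; omega)) (R.iso x).hom (by
        rw [BarChain.comp_cons, l.deg_comp, l.deg_comp, CatGrading.deg_of_isIso (R.iso x).inv,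
          CatGrading.deg_of_isIso (R.iso x).hom, ← h]
        push_cast
        omega)
    else 0

theorem barH_bas_of_eq_zero {r : ℕ} {z : C} (s : BarChain l R w r z) {x : C} (g : x ⟶ z) {j : ℤ}
    (h : (l.deg s.comp : ℤ) + l.deg g = j) (hg : l.deg g = 0) :
    barH r j (bas k s g h) = 0 :=
  (freeLin_freeBas _ _ _ _).trans (dif_neg (by simp [hg]))

/-- If a morphism `e ≫ f` of positive length is factored through an isomorphism `e` to a chosen
representative, then `e` agrees with the isomorphism used in the contracting homotopy. -/
theorem barH_bas (hl : l.IsIndiscretelyBased) {r : ℕ} {y : C} (s : BarChain l R w r y)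
    {x z : C} (hz : R.rep z = z) (e : x ⟶ z) (he : l.deg e = 0) (f : z ⟶ y) (hf : 0 < l.deg f)
    (g : x ⟶ y) (hg : e ≫ f = g) {j : ℤ} (h : (l.deg s.comp : ℤ) + l.deg g = j) :
    barH r j (bas k s g h) = bas k (BarChain.cons s hz f hf) e (by
      rw [← h, ← hg, BarChain.comp_cons, l.deg_comp, l.deg_comp]; push_cast; omega) := by
  have := hl.isIso e he
  obtain rfl : R.rep x = z := by rw [R.rep_eq (asIso e), hz]
  obtain rfl : e = (R.iso x).hom := hl.hom_eq he (CatGrading.deg_of_isIso _)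
  obtain rfl : f = (R.iso x).inv ≫ g := by rw [← hg, Iso.inv_hom_id_assoc]
  refine (freeLin_freeBas _ _ _ _).trans (dif_pos ?_)
  rw [← hg, l.deg_comp]
  omega

theorem bar_lhom_ext {V : Type*} [AddCommGroup V] [Module k V] {r : ℕ} {j : ℤ}
    {φ ψ : (barMod k R w l r).piece j →ₗ[k] V}
    (h : ∀ (z : C) (s : BarChain l R w r z) (x : C) (g : x ⟶ z)
      (hg : (l.deg s.comp : ℤ) + l.deg g = j), φ (bas k s g hg) = ψ (bas k s g hg)) : φ = ψ :=
  free_lhom_ext fun t x g hg => h t.1 t.2 x g hg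

/-- The map `barH` is a contracting homotopy in positive degrees. -/
theorem barD_barH_add (hl : l.IsIndiscretelyBased) (r : ℕ) (j : ℤ)
    (x : (barMod k R w l (r + 1)).piece j) :
    (barD k l R w (r + 1)).app j (barH (r + 1) j x) + barH r j ((barD k l R w r).app j x) = x := by
  refine LinearMap.congr_fun (f := ((barD k l R w (r + 1)).app j).comp (barH (r + 1) j) +
    (barH r j).comp ((barD k l R w r).app j)) (g := LinearMap.id) (bar_lhom_ext ?_) x
  intro z s x g hg
  simp only [LinearMap.add_apply, LinearMap.comp_apply, LinearMap.id_apply]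
  cases s with
  | cons s hz f hf =>
    rw [barD_bas, map_add, map_sum]
    simp only [map_smul]
    rcases Nat.eq_zero_or_pos (l.deg g) with h0 | h0
    -- If `g` is an isomorphism, only the first term of the differential survives `barH`, which
    -- splits `g ≫ f` into `g` and `f` again.
    · rw [barH_bas_of_eq_zero _ _ _ h0, map_zero, zero_add,
        barH_bas hl s hz g h0 f hf _ rfl]
      simp only [barH_bas_of_eq_zero _ _ _ h0, smul_zero, Finset.sum_const_zero, add_zero]
    -- Otherwise `barH` appends `g`, and every term of `barH (barD x)` cancels an inner face of the
    -- extended chain.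
    · have hι : l.deg (R.iso x).hom = 0 := CatGrading.deg_of_isIso _
      have hι' : l.deg (R.iso x).inv = 0 := CatGrading.deg_of_isIso _
      have hg' : 0 < l.deg ((R.iso x).inv ≫ g) := by rw [l.deg_comp]; omega
      have e1 : (R.iso x).hom ≫ (R.iso x).inv ≫ g = g := Iso.hom_inv_id_assoc _ _
      rw [barH_bas hl _ (R.rep_rep x) (R.iso x).hom hι _ hg' g e1, barD_bas,
        barH_bas hl s (R.rep_rep x) (R.iso x).hom hι (((R.iso x).inv ≫ g) ≫ f)
          (by rw [l.deg_comp]; omega) (g ≫ f) (by rw [← Category.assoc, e1]),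
        bas_congr _ rfl e1, Fin.sum_univ_succ]
      have e2 : ∀ (i : Fin r) hx, barH r j (bas k ((BarChain.cons s hz f hf).face i) g hx) =
          bas k (BarChain.cons ((BarChain.cons s hz f hf).face i) (R.rep_rep x)
            ((R.iso x).inv ≫ g) hg') (R.iso x).hom (by
              rw [← hx, BarChain.comp_cons, l.deg_comp, l.deg_comp]; push_cast; omega) :=
        fun i hx => barH_bas hl _ _ _ hι _ hg' g e1 hx
      simp only [e2, BarChain.face_zero, BarChain.face_succ, BarChain.precomp_cons, Fin.val_zero,
        Fin.val_succ, pow_succ, pow_zero, mul_neg, mul_one, neg_smul, one_smul, neg_neg,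
        Finset.sum_neg_distrib]
      abel

end GrMod

/-! ### The resolution of a simple module -/

namespace GrMod

variable {k : Type w} [Field k] {C : Type u} [Category.{v} C] {l : CatGrading C}

theorem simple_piece_eq_zero (hl : l.IsIndiscretelyBased) (c : C) {j : ℤ} (hj : j ≠ 0)
    (a : (simple k hl c).piece j) : a = 0 :=
  Finsupp.ext fun b => absurd b.deg_eq hj

theorem simple_rmul_of_pos (hl : l.IsIndiscretelyBased) (c : C) {x y : C} (f : x ⟶ y)
    (hf : 0 < l.deg f) {i j : ℤ} (h : i + l.deg f = j) (a : (simple k hl c).piece i) :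
    (simple k hl c).rmul f h a = 0 := by
  by_cases hi : i = 0
  · exact simple_piece_eq_zero hl c (by omega) _
  · rw [simple_piece_eq_zero hl c hi a, map_zero]

/-- The basis vector of a simple module at an object. -/
def simpleBas (k : Type w) [Field k] (hl : l.IsIndiscretelyBased) {c z : C}
    (hz : Nonempty (z ≅ c)) {j : ℤ} (hj : j = 0) : (simple k hl c).piece j :=
  (Finsupp.single ⟨z, hz, hj⟩ 1 : SimpleIdx c j →₀ k)

/-- The coordinate of an element of a simple module at an object. -/
def simpleCoord (k : Type w) [Field k] (hl : l.IsIndiscretelyBased) {c z : C}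
    (hz : Nonempty (z ≅ c)) {j : ℤ} (hj : j = 0) : (simple k hl c).piece j →ₗ[k] k :=
  (Finsupp.lapply ⟨z, hz, hj⟩ : (SimpleIdx c j →₀ k) →ₗ[k] k)

theorem simpleCoord_simpleBas (hl : l.IsIndiscretelyBased) {c z : C}
    (hz : Nonempty (z ≅ c)) {j : ℤ} (hj : j = 0) :
    simpleCoord k hl hz hj (simpleBas k hl hz hj) = 1 :=
  Finsupp.single_eq_same

theorem simple_lhom_ext (hl : l.IsIndiscretelyBased) {c : C} {V : Type*} [AddCommGroup V]
    [Module k V] {j : ℤ} {φ ψ : (simple k hl c).piece j →ₗ[k] V}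
    (h : ∀ (z : C) (hz : Nonempty (z ≅ c)) (hj : j = 0),
      φ (simpleBas k hl hz hj) = ψ (simpleBas k hl hz hj)) : φ = ψ :=
  Finsupp.lhom_ext' fun ⟨z, hz, hj⟩ => LinearMap.ext_ring (h z hz hj)

theorem simple_ext (hl : l.IsIndiscretelyBased) {c : C} {j : ℤ} {a b : (simple k hl c).piece j}
    (h : ∀ (z : C) (hz : Nonempty (z ≅ c)) (hj : j = 0),
      simpleCoord k hl hz hj a = simpleCoord k hl hz hj b) : a = b :=
  Finsupp.ext fun ⟨z, hz, hj⟩ => h z hz hj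

theorem simple_rmul_of_isIso (hl : l.IsIndiscretelyBased) {c : C} {x y : C} (f : x ⟶ y)
    (hf : l.deg f = 0) {i j : ℤ} (h : i + l.deg f = j) (hy : Nonempty (y ≅ c)) (hi : i = 0)
    (hx : Nonempty (x ≅ c)) :
    (simple k hl c).rmul f h (simpleBas k hl hy hi) = simpleBas k hl hx (by omega) := by
  refine (simpleAct_of c j ⟨y, hy, hi⟩ ⟨x, y, f⟩).trans ?_
  rw [simpleBasisAct, dif_pos ⟨⟨rfl, hl.isIso f hf⟩, by omega⟩]
  rfl

/-- An element of a simple module that is fixed by the identity of an object `z` is supported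
at `z`. -/
theorem simpleCoord_rmul_id (hl : l.IsIndiscretelyBased) {c : C} (z : C) {i j : ℤ}
    (h : i + l.deg (𝟙 z) = j) (a : (simple k hl c).piece i) {y : C} (hy : Nonempty (y ≅ c))
    (hj : j = 0) (hyz : y ≠ z) :
    simpleCoord k hl hy hj ((simple k hl c).rmul (𝟙 z) h a) = 0 := by
  refine LinearMap.congr_fun (f := (simpleCoord k hl hy hj).comp
    ((simple k hl c).rmul (𝟙 z) h)) (g := 0) (simple_lhom_ext hl fun x hx hi => ?_) a
  refine (congrArg (fun q : SimpleIdx c j →₀ k => q ⟨y, hy, hj⟩)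
    (simpleAct_of (k := k) c j ⟨x, hx, hi⟩ ⟨z, z, 𝟙 z⟩)).trans ?_
  rw [simpleBasisAct]
  split_ifs with hs
  · exact Finsupp.single_eq_of_ne (fun q => hyz (congrArg SimpleIdx.obj q))
  · rfl

variable (k)

/-- The augmentation of the bar resolution: it sends the empty chain to the basis vector at `w`. -/
def barAug (hl : l.IsIndiscretelyBased) (R : ObjReps C) (w : C) :
    barMod k R w l 0 ⟶ simple k hl w :=
  freeLift fun t => simpleBas k hl (z := t.1) (by obtain ⟨_, ⟨⟩⟩ := t; exact ⟨Iso.refl _⟩)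
    (by obtain ⟨_, ⟨⟩⟩ := t; rw [BarChain.comp_nil, l.deg_id]; rfl)

variable {k} {R : ObjReps C} {w : C}

theorem barAug_bas_of_eq_zero (hl : l.IsIndiscretelyBased) {x : C} (g : x ⟶ w) {j : ℤ}
    (h : (l.deg (BarChain.nil : BarChain l R w 0 w).comp : ℤ) + l.deg g = j) (hg : l.deg g = 0)
    (hx : Nonempty (x ≅ w)) (hj : j = 0) :
    (barAug k hl R w).app j (bas k BarChain.nil g h) = simpleBas k hl hx hj :=
  (freeLift_freeBas _ _ _ _).trans (simple_rmul_of_isIso hl g hg _ _ _ hx)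

theorem barAug_bas_of_pos (hl : l.IsIndiscretelyBased) {x : C} (g : x ⟶ w) {j : ℤ}
    (h : (l.deg (BarChain.nil : BarChain l R w 0 w).comp : ℤ) + l.deg g = j) (hg : 0 < l.deg g) :
    (barAug k hl R w).app j (bas k BarChain.nil g h) = 0 :=
  (freeLift_freeBas _ _ _ _).trans (simple_rmul_of_pos hl w g hg _ _)

/-- The contracting homotopy of the bar resolution in degree `-1`. -/
def barHAug (hl : l.IsIndiscretelyBased) (j : ℤ) :
    (simple k hl w).piece j →ₗ[k] (barMod k R w l 0).piece j :=
  Finsupp.linearCombination k fun b : SimpleIdx w j =>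
    bas k BarChain.nil b.iso.some.hom (by
      rw [CatGrading.deg_of_isIso b.iso.some.hom, b.deg_eq, BarChain.comp_nil, l.deg_id]; simp)

theorem barHAug_simpleBas (hl : l.IsIndiscretelyBased) {x : C} (hx : Nonempty (x ≅ w)) {j : ℤ}
    (hj : j = 0) (g : x ⟶ w) (hg : l.deg g = 0) :
    barHAug (R := R) hl j (simpleBas k hl hx hj) =
      bas k (BarChain.nil : BarChain l R w 0 w) g (by
        rw [hg, hj, BarChain.comp_nil, l.deg_id]; simp) := by
  refine (Finsupp.linearCombination_single k 1 _).trans ((one_smul k _).trans ?_)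
  exact bas_congr _ rfl (hl.hom_eq (CatGrading.deg_of_isIso _) hg)

/-- The contracting homotopy in degree zero. -/
theorem barD_barH_add_barAug (hl : l.IsIndiscretelyBased) (j : ℤ)
    (x : (barMod k R w l 0).piece j) :
    (barD k l R w 0).app j (barH 0 j x) + barHAug hl j ((barAug k hl R w).app j x) = x := by
  refine LinearMap.congr_fun (f := ((barD k l R w 0).app j).comp (barH 0 j) +
    (barHAug hl j).comp ((barAug k hl R w).app j)) (g := LinearMap.id) (bar_lhom_ext ?_) x
  intro z s x g hg
  simp only [LinearMap.add_apply, LinearMap.comp_apply, LinearMap.id_apply]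
  cases s with
  | nil =>
    rcases Nat.eq_zero_or_pos (l.deg g) with h0 | h0
    · have := hl.isIso g h0
      rw [barH_bas_of_eq_zero _ _ _ h0, map_zero, zero_add, barAug_bas_of_eq_zero hl g hg h0
        ⟨asIso g⟩ (by rw [← hg, h0, BarChain.comp_nil, l.deg_id]; simp),
        barHAug_simpleBas hl _ _ g h0]
    · have hι : l.deg (R.iso x).hom = 0 := CatGrading.deg_of_isIso _
      have hι' : l.deg (R.iso x).inv = 0 := CatGrading.deg_of_isIso _
      have e1 : (R.iso x).hom ≫ (R.iso x).inv ≫ g = g := Iso.hom_inv_id_assoc _ _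
      rw [barH_bas hl _ (R.rep_rep x) (R.iso x).hom hι _ (by rw [l.deg_comp]; omega) g e1, barD_bas,
        barAug_bas_of_pos hl g hg h0, map_zero, add_zero, Finset.univ_eq_empty, Finset.sum_empty,
        add_zero]
      exact bas_congr _ rfl e1

theorem barD_barAug (hl : l.IsIndiscretelyBased) : barD k l R w 0 ≫ barAug k hl R w = 0 := by
  refine free_hom_ext ?_
  rintro ⟨z, s⟩
  cases s with
  | cons s hz f hf =>
    cases s with
    | nil =>
      refine (congrArg ((barAug k hl R w).app _) (barD_bas _ hz f hf (𝟙 z) _)).trans ?_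
      rw [Finset.univ_eq_empty, Finset.sum_empty, add_zero, barAug_bas_of_pos]
      · rfl
      · rw [l.deg_comp]
        omega

/-- A generator is of the form `barH x`, so its differential is `x - barH (barD x)`. The
differential of this vanishes if `barD (barH (barD x)) = barD x`, which follows from the homotopy in the previous
degree. -/
theorem barD_barD (hl : l.IsIndiscretelyBased) (r : ℕ) :
    barD k l R w (r + 1) ≫ barD k l R w r = 0 := by
  have key : ∀ r : ℕ, (∀ (j : ℤ) (x : (barMod k R w l (r + 1)).piece j),
      (barD k l R w r).app j (barH r j ((barD k l R w r).app j x)) = (barD k l R w r).app j x) →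
      barD k l R w (r + 1) ≫ barD k l R w r = 0 := by
    intro r hr
    refine free_hom_ext ?_
    rintro ⟨z, s⟩
    cases s with
    | cons s hz f hf =>
      have h : (l.deg s.comp : ℤ) + l.deg f = l.deg (BarChain.cons s hz f hf).comp := by
        rw [BarChain.comp_cons, l.deg_comp]
        push_cast
        omega
      have e := barH_bas hl (k := k) s hz (𝟙 z) (l.deg_id z) f hf f (Category.id_comp f) h
      refine (congrArg (fun x => (barD k l R w r).app _ ((barD k l R w (r + 1)).app _ x))
        e.symm).trans ?_
      rw [eq_sub_of_add_eq (barD_barH_add hl r _ (bas k s f h)), map_sub, hr, sub_self]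
      rfl
  induction r with
  | zero =>
    refine key 0 fun j x => ?_
    have h := barD_barH_add_barAug hl j ((barD k l R w 0).app j x)
    have h0 : (barAug k hl R w).app j ((barD k l R w 0).app j x) = 0 :=
      congrArg (fun q => Hom.app q j x) (barD_barAug (k := k) (R := R) (w := w) hl)
    rwa [h0, map_zero, add_zero] at h
  | succ r ih =>
    refine key (r + 1) fun j x => ?_
    have h := barD_barH_add hl r j ((barD k l R w (r + 1)).app j x)
    have h0 : (barD k l R w r).app j ((barD k l R w (r + 1)).app j x) = 0 :=
      congrArg (fun q => Hom.app q j x) ih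
    rwa [h0, map_zero, add_zero] at h

theorem exact_barD (hl : l.IsIndiscretelyBased) (r : ℕ) :
    (ShortComplex.mk _ _ (barD_barD (k := k) (R := R) (w := w) hl r)).Exact :=
  exact_of_forall fun i x hx => ⟨barH (r + 1) i x, by
    have h := barD_barH_add hl r i x
    dsimp only at hx ⊢
    rwa [hx, map_zero, add_zero] at h⟩

theorem exact_barAug (hl : l.IsIndiscretelyBased) :
    (ShortComplex.mk _ _ (barD_barAug (k := k) (R := R) (w := w) hl)).Exact :=
  exact_of_forall fun i x hx => ⟨barH 0 i x, by
    have h := barD_barH_add_barAug hl i x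
    dsimp only at hx ⊢
    rwa [hx, map_zero, add_zero] at h⟩

instance epi_barAug (hl : l.IsIndiscretelyBased) : Epi (barAug k hl R w) :=
  epi_of_surjective _ fun j => by
    have h : ((barAug k hl R w).app j).comp (barHAug hl j) = LinearMap.id :=
      simple_lhom_ext hl fun z hz hj => by
        have hd : l.deg hz.some.hom = 0 := CatGrading.deg_of_isIso _
        rw [LinearMap.comp_apply, barHAug_simpleBas hl hz hj _ hd,
          barAug_bas_of_eq_zero hl _ _ hd hz hj, LinearMap.id_apply]
    exact fun x => ⟨_, LinearMap.congr_fun h x⟩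

end GrMod

/-! ### Extensions from a projective resolution -/

section Ext

open Abelian

/-- An exact complex of projective objects that is augmented to `X` is a projective resolution. -/
def projectiveResolutionOfExact {A : Type*} [Category* A] [Abelian A] {X : A} (P : ℕ → A)
    (hP : ∀ n, Projective (P n)) (d : ∀ n, P (n + 1) ⟶ P n) (hd : ∀ n, d (n + 1) ≫ d n = 0)
    (hexact : ∀ n, (ShortComplex.mk _ _ (hd n)).Exact) (ε : P 0 ⟶ X) [hepi : Epi ε]
    (hε : d 0 ≫ ε = 0) (hexact₀ : (ShortComplex.mk _ _ hε).Exact) :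
    ProjectiveResolution X where
  complex := ChainComplex.of P d hd
  projective := hP
  π := (ChainComplex.toSingle₀Equiv _ _).symm ⟨ε,
    (congrArg (· ≫ ε) (ChainComplex.of_d P d 0)).trans hε⟩
  quasiIso := ⟨fun n => by
    cases n with
    | zero =>
      rw [ChainComplex.quasiIsoAt₀_iff, ShortComplex.quasiIso_iff_of_zeros' _ rfl rfl rfl]
      refine (ShortComplex.exact_and_epi_g_iff_of_iso ?_).2 ⟨hexact₀, hepi⟩
      exact ShortComplex.isoMk (Iso.refl _) (Iso.refl _) (Iso.refl _)
        ((Category.id_comp _).trans ((ChainComplex.of_d P d 0).symm.trans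
          (Category.comp_id _).symm))
        ((Category.id_comp _).trans ((ChainComplex.toSingle₀Equiv_symm_apply_f_zero
          (C := ChainComplex.of P d hd) ε
          ((congrArg (· ≫ ε) (ChainComplex.of_d P d 0)).trans hε)).symm.trans
          (Category.comp_id _).symm))
    | succ n =>
      rw [quasiIsoAt_iff_exactAt' (hL := ChainComplex.exactAt_succ_single_obj ..),
        HomologicalComplex.exactAt_iff' _ (n + 2) (n + 1) n (by simp) (by simp)]
      refine (ShortComplex.exact_iff_of_iso ?_).2 (hexact n)
      exact ShortComplex.isoMk (Iso.refl _) (Iso.refl _) (Iso.refl _)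
        ((Category.id_comp _).trans ((ChainComplex.of_d P d (n + 1)).symm.trans
          (Category.comp_id _).symm))
        ((Category.id_comp _).trans ((ChainComplex.of_d P d n).symm.trans
          (Category.comp_id _).symm))⟩

/-- The linear map from the cocycles in the complex of homomorphisms out of a projective resolution
to the extensions. -/
def extOfCocycle (k : Type*) [Field k] {A : Type*} [Category* A] [Abelian A] [Linear k A]
    [HasExt A] {X : A} (R : ProjectiveResolution X) (N : A) (n : ℕ) :
    LinearMap.ker (Linear.leftComp k N (R.complex.d (n + 1) n)) →ₗ[k] Ext X N n where
  toFun φ := R.extMk φ.1 (n + 1) rfl φ.2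
  map_add' φ ψ := (R.add_extMk φ.1 ψ.1 (n + 1) rfl φ.2 ψ.2).symm
  map_smul' r φ := by
    rw [RingHom.id_apply, Ext.smul_eq_comp_mk₀]
    have e : (r • φ).1 = φ.1 ≫ (r • 𝟙 N) := by simp
    refine Eq.trans ?_ (R.extMk_comp_mk₀ φ.1 (n + 1) rfl φ.2 (r • 𝟙 N)).symm
    congr 1

theorem extOfCocycle_surjective (k : Type*) [Field k] {A : Type*} [Category* A] [Abelian A]
    [Linear k A] [HasExt A] {X : A} (R : ProjectiveResolution X) (N : A) (n : ℕ) :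
    Function.Surjective (extOfCocycle k R N n) := fun α => by
  obtain ⟨φ, hφ, h⟩ := R.extMk_surjective α (n + 1) rfl
  exact ⟨⟨φ, hφ⟩, h⟩

theorem extOfCocycle_eq_zero_iff (k : Type*) [Field k] {A : Type*} [Category* A] [Abelian A]
    [Linear k A] [HasExt A] {X : A} (R : ProjectiveResolution X) (N : A) (n : ℕ)
    (φ : LinearMap.ker (Linear.leftComp k N (R.complex.d (n + 2) (n + 1)))) :
    extOfCocycle k R N (n + 1) φ = 0 ↔ ∃ ψ : R.complex.X n ⟶ N, R.complex.d (n + 1) n ≫ ψ = φ.1 :=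
  R.extMk_eq_zero_iff φ.1 (n + 2) rfl φ.2 n rfl

end Ext

namespace GrMod

variable (k : Type w) [Field k] {C : Type u} [Category.{v} C] {l : CatGrading C}

/-- The reduced bar resolution of a simple module. -/
def barResolution (hl : l.IsIndiscretelyBased) (R : ObjReps C) (w : C) :
    ProjectiveResolution (simple k hl w) :=
  projectiveResolutionOfExact (barMod k R w l) (fun _ => projective_freeMod) (barD k l R w)
    (barD_barD hl) (exact_barD hl) (barAug k hl R w) (barD_barAug hl) (exact_barAug hl)

theorem barResolution_d (hl : l.IsIndiscretelyBased) (R : ObjReps C) (w : C) (n : ℕ) :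
    (barResolution k hl R w).complex.d (n + 1) n = barD k l R w n :=
  ChainComplex.of_d _ _ n

/-! ### Homomorphisms from a free module to a shifted simple module -/

section HomFree

variable {k} {T : Type (max u v)} {c : T → C} {d : T → ℤ}

theorem shift_rmul (M : GrMod.{w, v, u} k l) (m : ℤ) {x y : C} (f : x ⟶ y) {i j : ℤ}
    (h : i + l.deg f = j) (a : (M.shift m).piece i) :
    (M.shift m).rmul f h a = M.rmul f (i := m + i) (j := m + j) (by omega) a := rfl

/-- The coordinates of the values of a homomorphism from a free module to the shifted simple module
`S_v(-n)` on the generators of degree `n` at the objects isomorphic to `v`. -/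
def freeHomCoord (k : Type w) [Field k] (hl : l.IsIndiscretelyBased) (c : T → C) (d : T → ℤ) (v : C)
    (n : ℤ) :
    (freeMod k l c d ⟶ (simple k hl v).shift (-n)) →ₗ[k]
      ({t : T // Nonempty (c t ≅ v) ∧ d t = n} → k) where
  toFun φ t := simpleCoord k hl (j := -n + n) t.2.1 (neg_add_cancel n)
    (φ.app n (freeBas k l c d t.1 (𝟙 _) (by rw [l.deg_id, t.2.2]; simp)))
  map_add' _ _ := rfl
  map_smul' _ _ := rfl

/-- The coordinates determine a homomorphism: a generator `t` is fixed by the identity of `c t`, so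
its image is supported at `c t`. -/
theorem freeHomCoord_injective (hl : l.IsIndiscretelyBased) (v : C) (n : ℤ) :
    Function.Injective (freeHomCoord k hl c d v n) := by
  rw [injective_iff_map_eq_zero]
  intro φ hφ
  refine free_hom_ext fun t => ?_
  by_cases hn : d t = n
  · refine simple_ext hl fun z hz hj => ?_
    rw [zero_app]
    refine Eq.trans ?_ (map_zero _).symm
    by_cases hzt : z = c t
    · subst hzt
      have := congrFun hφ ⟨t, hz, hn⟩
      subst hn
      exact this
    · rw [freeBas_eq_rmul, Hom.app_rmul, shift_rmul]
      exact simpleCoord_rmul_id hl _ _ _ hz _ hzt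
  · exact simple_piece_eq_zero hl v (j := -n + d t) (by omega) _

theorem freeHomCoord_surjective (hl : l.IsIndiscretelyBased) (v : C) (n : ℤ) :
    Function.Surjective (freeHomCoord k hl c d v n) := by
  classical
  intro ψ
  let a : ∀ t, (simple k hl v).piece (-n + d t) := fun t =>
    if h : Nonempty (c t ≅ v) ∧ d t = n then ψ ⟨t, h⟩ • simpleBas k hl h.1 (by omega) else 0
  refine ⟨freeLift (N := (simple k hl v).shift (-n)) a, funext fun t => ?_⟩
  refine (congrArg (simpleCoord k hl t.2.1 (neg_add_cancel n)) (freeLift_freeBas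
    (N := (simple k hl v).shift (-n)) a t.1 (𝟙 _) _)).trans ?_
  change simpleCoord k hl t.2.1 (neg_add_cancel n) ((simple k hl v).rmul (𝟙 (c t.1))
    (i := -n + d t.1) (by rw [l.deg_id, t.2.2]; simp) (a t.1)) = ψ t
  have ha : a t.1 = ψ t • simpleBas k hl t.2.1 (by have := t.2.2; omega) := dif_pos t.2
  rw [ha, map_smul, map_smul, simple_rmul_of_isIso hl (𝟙 (c t.1)) (l.deg_id _) _ t.2.1 _ t.2.1,
    simpleCoord_simpleBas, smul_eq_mul, mul_one]

end HomFree

end GrMod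

/-! ### Faces of composable arrows -/

namespace CategoryTheory.ComposableArrows

variable {D : Type*} [Category* D]

/-- The functor `[n] ⥤ [n + 1]` that omits `i`. -/
def faceFunctor {n : ℕ} (i : Fin (n + 2)) : Fin (n + 1) ⥤ Fin (n + 2) :=
  (Fin.succAboveOrderEmb i).monotone.functor

theorem faceFunctor_obj {n : ℕ} (i : Fin (n + 2)) (x : Fin (n + 1)) :
    (faceFunctor i).obj x = i.succAbove x := rfl

/-- Omitting the first object. -/
def faceZeroIso {n : ℕ} (K : ComposableArrows D (n + 1)) : faceFunctor 0 ⋙ K ≅ K.δ₀ :=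
  Functor.isoWhiskerRight (NatIso.ofComponents (fun x => eqToIso (by
    simp [faceFunctor_obj])) (fun _ => Subsingleton.elim _ _) :
      faceFunctor 0 ≅ Fin.succFunctor (n + 1)) K

theorem map_faceZeroIso {n : ℕ} (K : ComposableArrows D (n + 1)) :
    K.map (homOfLE (Fin.zero_le ((faceFunctor 0).obj 0))) ≫ K.faceZeroIso.hom.app 0 =
      K.map' 0 1 := by
  refine (K.map_comp _ _).symm.trans ?_
  exact congrArg K.map (Subsingleton.elim _ _)

/-- An isomorphism from the `i`-th face of `K` to `L` extends to an isomorphism from the face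
number `i + 1` of a chain that extends `K` to a chain that extends `L`. -/
theorem exists_face_precomp_iso {n : ℕ} (K : ComposableArrows D (n + 1)) (L : ComposableArrows D n)
    {X X' : D} (f : X ⟶ K.left) (f' : X' ⟶ L.left) (a : X ≅ X') (i : Fin (n + 2))
    (β : faceFunctor i ⋙ K ≅ L)
    (h : f ≫ K.map (homOfLE (Fin.zero_le ((faceFunctor i).obj 0))) ≫ β.hom.app 0 = a.hom ≫ f') :
    ∃ γ : faceFunctor i.succ ⋙ K.precomp f ≅ L.precomp f',
      (K.precomp f).map (homOfLE (Fin.zero_le ((faceFunctor i.succ).obj 0))) ≫ γ.hom.app 0 =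
        a.hom := by
  let P := K.precomp f
  have h0 : (faceFunctor i.succ).obj 0 = 0 := Fin.succAbove_ne_zero_zero (Fin.succ_ne_zero i)
  let θ : Fin.succFunctor (n + 1) ⋙ faceFunctor i.succ ≅
      faceFunctor i ⋙ Fin.succFunctor (n + 2) :=
    NatIso.ofComponents (fun x => eqToIso (Fin.succ_succAbove_succ i x))
      (fun _ => Subsingleton.elim _ _)
  let G : ComposableArrows D (n + 1) := faceFunctor i.succ ⋙ P
  let β' : G.δ₀ ≅ (L.precomp f').δ₀ :=
    Functor.isoWhiskerRight θ P ≪≫ β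
  let α : G.obj' 0 ≅ (L.precomp f').obj' 0 :=
    P.mapIso (eqToIso h0) ≪≫ a
  have e1 : P.map (homOfLE (Fin.zero_le ((faceFunctor i).obj 0).succ)) =
      f ≫ K.map (homOfLE (Fin.zero_le ((faceFunctor i).obj 0))) :=
    P.map_comp (Y := ⟨1, by omega⟩) (homOfLE (Fin.zero_le _))
      ((Fin.succFunctor (n + 2)).map (homOfLE (Fin.zero_le ((faceFunctor i).obj 0))))
  have e2 : P.map (homOfLE (Fin.zero_le ((faceFunctor i).obj 0).succ)) ≫ β.hom.app 0 =
      a.hom ≫ f' := (congrArg (· ≫ β.hom.app 0) e1).trans ((Category.assoc _ _ _).trans h)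
  have e3 : G.map' 0 1 ≫ P.map (θ.hom.app 0) =
      P.map (eqToHom h0) ≫ P.map (homOfLE (Fin.zero_le ((faceFunctor i).obj 0).succ)) :=
    (P.map_comp ((faceFunctor i.succ).map (homOfLE (Fin.zero_le 1))) (θ.hom.app 0)).symm.trans
      (P.map_comp (eqToHom h0) (homOfLE (Fin.zero_le ((faceFunctor i).obj 0).succ)))
  refine ⟨isoMkSucc α β' ?_, ?_⟩
  · exact (Category.assoc _ _ _).symm.trans ((congrArg (· ≫ β.hom.app 0) e3).trans
      ((Category.assoc _ _ _).trans ((congrArg (P.map (eqToHom h0) ≫ ·) e2).trans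
        (Category.assoc _ _ _).symm)))
  · refine (Category.assoc _ _ _).symm.trans ?_
    refine (congrArg (· ≫ a.hom) ((P.map_comp _ (eqToHom h0)).symm.trans (P.map_id _))).trans ?_
    exact Category.id_comp _

end CategoryTheory.ComposableArrows

/-! ### Reduced chains and nontrivial factorizations -/

open ComposableArrows

namespace BarChain

variable {C : Type u} [Category.{v} C] {l : CatGrading C} {R : ObjReps C} {w : C}

/-- A nonempty chain `z = x_m → ⋯ → x_0 → w`, seen as a chain of `m` composable arrows in the
category of objects over `w`, together with an isomorphism from the composite of the chain to the
first object. -/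
def arrows : ∀ {m : ℕ} {z : C} (s : BarChain l R w (m + 1) z),
    Σ K : ComposableArrows (Over w) m, (Over.mk s.comp ≅ K.left)
  | 0, _, cons s hz f hf => ⟨mk₀ (Over.mk (cons s hz f hf).comp), Iso.refl _⟩
  | _ + 1, _, cons s hz f hf =>
    ⟨s.arrows.1.precomp (X := Over.mk (cons s hz f hf).comp)
      (Over.homMk (V := Over.mk s.comp) f ≫ s.arrows.2.hom), Iso.refl _⟩

/-- The morphism from the source of a chain to the first object of the associated chain of arrows;
it is the identity up to definitional unfolding. -/
def toLeft {m : ℕ} {z : C} (s : BarChain l R w (m + 1) z) : z ⟶ s.arrows.1.left.left :=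
  s.arrows.2.hom.left

theorem toLeft_hom {m : ℕ} {z : C} (s : BarChain l R w (m + 1) z) :
    s.toLeft ≫ s.arrows.1.left.hom = s.comp :=
  Over.w s.arrows.2.hom

/-- The inverse of `toLeft`. -/
def fromLeft {m : ℕ} {z : C} (s : BarChain l R w (m + 1) z) : s.arrows.1.left.left ⟶ z :=
  s.arrows.2.inv.left

@[simp] theorem toLeft_fromLeft {m : ℕ} {z : C} (s : BarChain l R w (m + 1) z) :
    s.toLeft ≫ s.fromLeft = 𝟙 z :=
  congrArg CommaMorphism.left s.arrows.2.hom_inv_id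

@[simp] theorem fromLeft_toLeft {m : ℕ} {z : C} (s : BarChain l R w (m + 1) z) :
    s.fromLeft ≫ s.toLeft = 𝟙 _ :=
  congrArg CommaMorphism.left s.arrows.2.inv_hom_id

instance {m : ℕ} {z : C} (s : BarChain l R w (m + 1) z) : IsIso s.toLeft :=
  ⟨s.fromLeft, s.toLeft_fromLeft, s.fromLeft_toLeft⟩

@[simp] theorem fromLeft_comp {m : ℕ} {z : C} (s : BarChain l R w (m + 1) z) :
    s.fromLeft ≫ s.comp = s.arrows.1.left.hom :=
  Over.w s.arrows.2.inv

/-- A chain of arrows over `w` is nontrivial if all its morphisms, including the last one to `w`,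
have positive length. -/
def _root_.CatGrading.ArrowsNontrivial (l : CatGrading C) {m : ℕ}
    (K : ComposableArrows (Over w) m) : Prop :=
  (∀ i j : Fin (m + 1), ∀ h : i < j, 0 < l.deg (K.map (homOfLE h.le)).left) ∧
    ∀ i : Fin (m + 1), 0 < l.deg (K.obj i).hom

theorem arrowsNontrivial_precomp {m : ℕ} {K : ComposableArrows (Over w) m}
    (hK : l.ArrowsNontrivial K) {X : Over w} (f : X ⟶ K.left) (hf : 0 < l.deg f.left) :
    l.ArrowsNontrivial (K.precomp f) := by
  constructor
  · rintro ⟨i, hi⟩ ⟨j, hj⟩ h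
    obtain _ | j := j
    · exact absurd h (Nat.not_lt_zero _)
    obtain _ | i := i
    · obtain _ | j := j
      · exact hf
      · change 0 < l.deg (f ≫ K.map (homOfLE _)).left
        rw [Over.comp_left, l.deg_comp]
        omega
    · exact hK.1 ⟨i, by omega⟩ ⟨j, by omega⟩ (by simpa [Fin.lt_def] using h)
  · rintro ⟨i, hi⟩
    obtain _ | i := i
    · change 0 < l.deg X.hom
      rw [← Over.w f, l.deg_comp]
      omega
    · exact hK.2 _

theorem arrowsNontrivial : ∀ {m : ℕ} {z : C} (s : BarChain l R w (m + 1) z),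
    l.ArrowsNontrivial s.arrows.1
  | 0, _, cons s hz f hf =>
    ⟨fun i j h => by
      exact absurd h (by omega), fun _ => (cons s hz f hf).deg_comp_pos⟩
  | m + 1, z, cons s hz f hf => by
    refine arrowsNontrivial_precomp (arrowsNontrivial s) _ ?_
    rw [Over.comp_left, l.deg_comp]
    exact Nat.add_pos_left hf _

/-- Chains with isomorphic chains of arrows are equal: isomorphic representatives are equal, and
their only automorphism is the identity. -/
theorem eq_of_arrows_iso (hl : l.IsIndiscretelyBased) : ∀ {m : ℕ} {z : C}
    (s s' : BarChain l R w (m + 1) z), (s.arrows.1 ≅ s'.arrows.1) → s = s'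
  | 0, z, cons s hz f hf, cons s' hz' f' hf', α => by
    cases s
    cases s'
    have h1 : (α.app 0).hom.left = 𝟙 z :=
      hl.hom_eq (CatGrading.deg_of_isIso ((Over.forget w).mapIso (α.app 0)).hom) (l.deg_id z)
    have h2 : (α.app 0).hom.left ≫ f' ≫ 𝟙 _ = f ≫ 𝟙 _ := Over.w (α.app 0).hom
    rw [h1] at h2
    have h3 : 𝟙 z ≫ f' ≫ 𝟙 w = f ≫ 𝟙 w := h2
    rw [Category.id_comp, Category.comp_id, Category.comp_id] at h3
    subst h3
    rfl
  | m + 1, z, cons (y := y) s hz f hf, cons (y := y') s' hz' f' hf', α => by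
    have β : s.arrows.1 ≅ s'.arrows.1 := δ₀Functor.mapIso α
    obtain rfl : y = y' := by
      have e : y ≅ y' := asIso s.toLeft ≪≫ (Over.forget w).mapIso (β.app 0) ≪≫
        (asIso s'.toLeft).symm
      rw [← s.rep_eq, ← s'.rep_eq, R.rep_eq e]
    obtain rfl := eq_of_arrows_iso hl s s' β
    have h1 : (α.app 0).hom.left = 𝟙 z :=
      hl.hom_eq (CatGrading.deg_of_isIso ((Over.forget w).mapIso (α.app 0)).hom) (l.deg_id z)
    have h2 : (α.app 1).hom.left = 𝟙 s.arrows.1.left.left :=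
      hl.hom_eq (CatGrading.deg_of_isIso ((Over.forget w).mapIso (α.app 1)).hom) (l.deg_id _)
    have h3 : (f ≫ s.toLeft) ≫ (α.app 1).hom.left = (α.app 0).hom.left ≫ f' ≫ s.toLeft :=
      congrArg CommaMorphism.left (naturality' α.hom 0 1)
    rw [h1, h2] at h3
    have h4 : (f ≫ s.toLeft) ≫ 𝟙 _ = 𝟙 z ≫ f' ≫ s.toLeft := h3
    rw [Category.id_comp, Category.comp_id, cancel_mono] at h4
    subst h4
    rfl

/-- Every nontrivial chain of arrows over `w` is isomorphic to one that comes from a reduced chain,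
obtained by replacing the objects by their representatives. -/
theorem exists_arrows_iso (R : ObjReps C) : ∀ {m : ℕ}
    (K : ComposableArrows (Over w) m), l.ArrowsNontrivial K → ∃ (z : C)
      (s : BarChain l R w (m + 1) z), Nonempty (K ≅ s.arrows.1)
  | 0, K, hK => by
    let e := R.iso K.left.left
    have hd : 0 < l.deg (e.inv ≫ K.left.hom) := by
      rw [l.deg_comp]
      exact Nat.add_pos_right _ (hK.2 0)
    refine ⟨_, cons nil (R.rep_rep K.left.left) (e.inv ≫ K.left.hom) hd, ⟨isoMk₀ ?_⟩⟩
    refine Over.isoMk e ?_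
    change e.hom ≫ (e.inv ≫ K.left.hom) ≫ 𝟙 w = K.left.hom
    simp
  | m + 1, K, hK => by
    have hK' : l.ArrowsNontrivial K.δ₀ :=
      ⟨fun i j h => hK.1 i.succ j.succ (Fin.succ_lt_succ_iff.2 h), fun i => hK.2 i.succ⟩
    obtain ⟨y, s, ⟨β⟩⟩ := exists_arrows_iso R K.δ₀ hK'
    let e := R.iso K.left.left
    let q : K.left.left ⟶ s.arrows.1.left.left := (K.map' 0 1).left ≫ (β.hom.app 0).left
    have hq : 0 < l.deg q :=
      (Nat.add_pos_left (hK.1 0 1 (by simp)) _).trans_eq (l.deg_comp _ _).symm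
    have hq' : q ≫ s.arrows.1.left.hom = K.left.hom :=
      (Category.assoc _ _ _).trans ((congrArg ((K.map' 0 1).left ≫ ·)
        (Over.w (β.hom.app 0))).trans (Over.w (K.map' 0 1)))
    have hg : 0 < l.deg (e.inv ≫ q ≫ s.fromLeft) := by
      rw [l.deg_comp, l.deg_comp]
      omega
    refine ⟨_, cons s (R.rep_rep K.left.left) (e.inv ≫ q ≫ s.fromLeft) hg,
      ⟨isoMkSucc (Over.isoMk e ?_) β ?_⟩⟩
    · change e.hom ≫ (e.inv ≫ q ≫ s.fromLeft) ≫ s.comp = K.left.hom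
      simp [hq']
    · ext
      change q = e.hom ≫ (e.inv ≫ q ≫ s.fromLeft) ≫ s.toLeft
      simp

/-- The chain of arrows of an inner face is a face of the chain of arrows. -/
theorem exists_face_iso : ∀ {m : ℕ} {z : C} (s : BarChain l R w (m + 2) z) (i : Fin (m + 1)),
    ∃ β : faceFunctor i.succ ⋙ s.arrows.1 ≅ (s.face i).arrows.1,
      s.toLeft ≫ (s.arrows.1.map (homOfLE (Fin.zero_le ((faceFunctor i.succ).obj 0)))).left ≫
        (β.hom.app 0).left = (s.face i).toLeft
  | 0, z, cons (cons nil hy g hg) hz f hf, i => by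
    obtain rfl : i = 0 := Fin.fin_one_eq_zero i
    let s : BarChain l R w 2 z := cons (cons nil hy g hg) hz f hf
    let a : Over.mk s.comp ≅ Over.mk (s.face 0).comp :=
      Over.isoMk (Iso.refl z) ((Category.id_comp _).trans (comp_face s 0))
    refine ⟨isoMk₀ a, ?_⟩
    exact (Category.id_comp _).trans ((congrArg (· ≫ 𝟙 z)
      (congrArg CommaMorphism.left (s.arrows.1.map_id 0))).trans (Category.comp_id _))
  | m + 1, z, cons (cons (y := x) (z := y) t hy g hg) hz f hf, ⟨0, _⟩ => by
    let s : BarChain l R w (m + 3) z := cons (cons t hy g hg) hz f hf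
    let a : Over.mk s.comp ≅ Over.mk (s.face 0).comp :=
      Over.isoMk (Iso.refl z) ((Category.id_comp _).trans (comp_face s 0))
    obtain ⟨γ, hγ⟩ := exists_face_precomp_iso (cons t hy g hg).arrows.1 t.arrows.1
      (X := Over.mk s.comp) (X' := Over.mk (s.face 0).comp)
      (Over.homMk (V := Over.mk (cons t hy g hg).comp) f ≫ (cons t hy g hg).arrows.2.hom)
      (Over.homMk (V := Over.mk t.comp) (f ≫ g) ≫ t.arrows.2.hom) a 0 (faceZeroIso _) (by
        refine (congrArg (_ ≫ ·) (map_faceZeroIso _)).trans ?_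
        ext
        change (f ≫ 𝟙 y) ≫ g ≫ t.toLeft = 𝟙 z ≫ (f ≫ g) ≫ t.toLeft
        simp)
    exact ⟨γ, (congrArg (𝟙 z ≫ ·) (congrArg CommaMorphism.left hγ)).trans (Category.id_comp _)⟩
  | m + 1, z, cons t hz f hf, ⟨j + 1, hj⟩ => by
    let i : Fin (m + 1) := ⟨j, by omega⟩
    let s : BarChain l R w (m + 3) z := cons t hz f hf
    let a : Over.mk s.comp ≅ Over.mk (s.face i.succ).comp :=
      Over.isoMk (Iso.refl z) ((Category.id_comp _).trans (comp_face s i.succ))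
    obtain ⟨β, hβ⟩ := exists_face_iso t i
    obtain ⟨γ, hγ⟩ := exists_face_precomp_iso t.arrows.1 (t.face i).arrows.1
      (X := Over.mk s.comp) (X' := Over.mk (s.face i.succ).comp)
      (Over.homMk (V := Over.mk t.comp) f ≫ t.arrows.2.hom)
      (Over.homMk (V := Over.mk (t.face i).comp) f ≫ (t.face i).arrows.2.hom) a i.succ β (by
        ext
        change (f ≫ t.toLeft) ≫ (t.arrows.1.map _).left ≫ (β.hom.app 0).left =
          𝟙 z ≫ f ≫ (t.face i).toLeft
        exact (Category.assoc _ _ _).trans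
          ((congrArg (f ≫ ·) hβ).trans (Category.id_comp _).symm))
    exact ⟨γ, (congrArg (𝟙 z ≫ ·) (congrArg CommaMorphism.left hγ)).trans (Category.id_comp _)⟩

end BarChain

/-! ### The cells of the semi-simplicial set of factorizations -/

section ToFact

variable {C : Type u} [Category.{v} C] {l : CatGrading C} {v w : C}

/-- The factorization `v → K₀ → ⋯ → K_m → w` of a morphism that is given by a chain of arrows over
`w` and a morphism from `v` to its first object. Since the intermediate objects of a factorization
are numbered from its target, the indices are reversed. -/
def toFact {m : ℕ} (K : ComposableArrows (Over w) m) (f : v ⟶ K.left.left) {p : v ⟶ w}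
    (h : f ≫ K.left.hom = p) : FactChain p m where
  obj i :=
    { mid := (K.obj i.unop.rev).left
      ι := f ≫ (K.map (homOfLE (Fin.zero_le i.unop.rev))).left
      π := (K.obj i.unop.rev).hom
      ι_π := (Category.assoc _ _ _).trans ((congrArg (f ≫ ·) (Over.w _)).trans h) }
  map {i _} g :=
    { h := (K.map (homOfLE (Fin.rev_le_rev.2 (leOfHom g.unop)))).left
      ι_h := (Category.assoc _ _ _).trans (congrArg (f ≫ ·) (congrArg CommaMorphism.left
        (K.map_comp (homOfLE (Fin.zero_le i.unop.rev))
          (homOfLE (Fin.rev_le_rev.2 (leOfHom g.unop)))).symm))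
      h_π := Over.w _ }
  map_id i := Factorisation.Hom.ext (congrArg CommaMorphism.left (K.map_id i.unop.rev))
  map_comp g g' := Factorisation.Hom.ext (congrArg CommaMorphism.left
    (K.map_comp (homOfLE (Fin.rev_le_rev.2 (leOfHom g.unop)))
      (homOfLE (Fin.rev_le_rev.2 (leOfHom g'.unop)))))

theorem toFact_isNontrivial (hl : l.IsIndiscretelyBased) {m : ℕ} {K : ComposableArrows (Over w) m}
    (hK : l.ArrowsNontrivial K) {f : v ⟶ K.left.left} (hf : 0 < l.deg f) {p : v ⟶ w}
    (h : f ≫ K.left.hom = p) : (toFact K f h).IsNontrivial where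
  first := by
    rw [hl.isIso_iff]
    exact (hK.2 _).ne'
  middle i := by
    rw [hl.isIso_iff]
    exact (hK.1 _ _ (Fin.rev_lt_rev.2 Fin.castSucc_lt_succ)).ne'
  last := by
    rw [hl.isIso_iff]
    exact ((Nat.add_pos_left hf _).trans_eq (l.deg_comp _ _).symm).ne'

/-- An isomorphism of factorizations, from isomorphisms of the intermediate objects. -/
def FactChain.isoMk {p : v ⟶ w} {m : ℕ} {F G : FactChain p m}
    (e : ∀ i, (F.obj i).mid ≅ (G.obj i).mid) (hι : ∀ i, (F.obj i).ι ≫ (e i).hom = (G.obj i).ι)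
    (hπ : ∀ i, (e i).hom ≫ (G.obj i).π = (F.obj i).π)
    (hn : ∀ {i j} (g : i ⟶ j), (F.map g).h ≫ (e j).hom = (e i).hom ≫ (G.map g).h) : F ≅ G :=
  NatIso.ofComponents (fun i =>
    { hom := { h := (e i).hom, ι_h := hι i, h_π := hπ i }
      inv := { h := (e i).inv, ι_h := by rw [← hι, Category.assoc, Iso.hom_inv_id, Category.comp_id]
               h_π := by rw [← hπ, Iso.inv_hom_id_assoc] }
      hom_inv_id := Factorisation.Hom.ext (e i).hom_inv_id
      inv_hom_id := Factorisation.Hom.ext (e i).inv_hom_id })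
    (fun g => Factorisation.Hom.ext (hn g))

/-- The isomorphism of the intermediate objects that is given by an isomorphism of
factorizations. -/
def FactChain.midIso {p : v ⟶ w} {m : ℕ} {F G : FactChain p m} (e : F ≅ G)
    (i : (Fin (m + 1))ᵒᵖ) : (F.obj i).mid ≅ (G.obj i).mid where
  hom := (e.hom.app i).h
  inv := (e.inv.app i).h
  hom_inv_id := congrArg Factorisation.Hom.h (e.hom_inv_id_app i)
  inv_hom_id := congrArg Factorisation.Hom.h (e.inv_hom_id_app i)

/-- Two chains of arrows define equivalent factorizations if and only if they are isomorphic,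
compatibly with the morphisms to their first objects. -/
theorem toFact_iso_iff {m : ℕ} {K K' : ComposableArrows (Over w) m} {f : v ⟶ K.left.left}
    {f' : v ⟶ K'.left.left} {p : v ⟶ w} {h : f ≫ K.left.hom = p} {h' : f' ≫ K'.left.hom = p} :
    Nonempty (toFact K f h ≅ toFact K' f' h') ↔
      ∃ β : K ≅ K', f ≫ (β.hom.app 0).left = f' := by
  constructor
  · rintro ⟨e⟩
    -- The given isomorphism is indexed by reversed indices; it is transported along `rev_rev`.
    let E : ∀ i : Fin (m + 1), K.obj i.rev ≅ K'.obj i.rev := fun i =>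
      Over.isoMk (FactChain.midIso e (op i)) (e.hom.app (op i)).h_π
    have hE : ∀ {a b : Fin (m + 1)} (hab : a ≤ b),
        K.map (homOfLE (Fin.rev_le_rev.2 hab)) ≫ (E a).hom =
          (E b).hom ≫ K'.map (homOfLE (Fin.rev_le_rev.2 hab)) := fun {a b} hab => by
      ext
      exact congrArg Factorisation.Hom.h (e.hom.naturality (homOfLE hab).op)
    refine ⟨NatIso.ofComponents (fun i => K.mapIso (eqToIso i.rev_rev.symm) ≪≫ E i.rev ≪≫
      K'.mapIso (eqToIso i.rev_rev)) fun {i j} g => ?_, ?_⟩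
    · have hji : j.rev ≤ i.rev := Fin.rev_le_rev.2 (leOfHom g)
      have e1 : K.map g ≫ K.map (eqToHom j.rev_rev.symm) =
          K.map (eqToHom i.rev_rev.symm) ≫ K.map (homOfLE (Fin.rev_le_rev.2 hji)) := by
        rw [← K.map_comp, ← K.map_comp]
        exact congrArg K.map (Subsingleton.elim _ _)
      have e2 : K'.map (homOfLE (Fin.rev_le_rev.2 hji)) ≫ K'.map (eqToHom j.rev_rev) =
          K'.map (eqToHom i.rev_rev) ≫ K'.map g := by
        rw [← K'.map_comp, ← K'.map_comp]
        exact congrArg K'.map (Subsingleton.elim _ _)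
      simp only [Iso.trans_hom, Functor.mapIso_hom, eqToIso.hom]
      rw [← Category.assoc, e1, Category.assoc, Category.assoc, Category.assoc,
        ← e2, ← Category.assoc (K.map (homOfLE _)), hE hji, Category.assoc]
    · have h1 : (f ≫ (K.map (homOfLE (Fin.zero_le _))).left) ≫ (E (Fin.rev 0)).hom.left =
          f' ≫ (K'.map (homOfLE (Fin.zero_le _))).left := (e.hom.app (op (Fin.rev 0))).ι_h
      have h2 : K'.map (homOfLE (Fin.zero_le _)) ≫ K'.map (eqToHom (Fin.rev_rev 0)) = 𝟙 _ := by
        rw [← K'.map_comp, ← K'.map_id]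
        exact congrArg K'.map (Subsingleton.elim _ _)
      have h3 := congrArg (· ≫ (K'.map (eqToHom (Fin.rev_rev 0))).left) h1
      have h4 := (Category.assoc _ _ _).symm.trans (h3.trans ((Category.assoc _ _ _).trans
        ((congrArg (f' ≫ ·) (congrArg CommaMorphism.left h2)).trans (Category.comp_id f'))))
      exact (Category.assoc f (K.map (homOfLE (Fin.zero_le (Fin.rev (Fin.rev 0))))).left
        ((E (Fin.rev 0)).hom.left ≫ (K'.map (eqToHom (Fin.rev_rev 0))).left)).symm.trans h4
  · rintro ⟨β, rfl⟩
    refine ⟨FactChain.isoMk (fun i => (Over.forget w).mapIso (β.app i.unop.rev)) (fun i => ?_)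
      (fun i => Over.w _) (fun {i j} g => congrArg CommaMorphism.left (β.hom.naturality _))⟩
    exact (Category.assoc _ _ _).trans ((congrArg (f ≫ ·) (congrArg CommaMorphism.left
      (β.hom.naturality _))).trans (Category.assoc _ _ _).symm)

/-- Every factorization is equivalent to one that is given by a chain of arrows. -/
theorem exists_toFact_iso {m : ℕ} {p : v ⟶ w} (F : FactChain p m) (hF : F.IsNontrivial)
    (hl : l.IsIndiscretelyBased) :
    ∃ (K : ComposableArrows (Over w) m) (f : v ⟶ K.left.left) (h : f ≫ K.left.hom = p),
      l.ArrowsNontrivial K ∧ 0 < l.deg f ∧ Nonempty (toFact K f h ≅ F) := by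
  let K : ComposableArrows (Over w) m :=
    { obj := fun i => Over.mk (F.obj (op i.rev)).π
      map := fun g => Over.homMk (F.map (homOfLE (Fin.rev_le_rev.2 (leOfHom g))).op).h
        (Factorisation.Hom.h_π _)
      map_id := fun i => by
        ext
        exact congrArg Factorisation.Hom.h (F.map_id (op i.rev))
      map_comp := fun g g' => by
        ext
        exact congrArg Factorisation.Hom.h (F.map_comp
          (homOfLE (Fin.rev_le_rev.2 (leOfHom g))).op
          (homOfLE (Fin.rev_le_rev.2 (leOfHom g'))).op) }
  refine ⟨K, (F.obj (op (Fin.rev 0))).ι, Factorisation.ι_π _,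
    ⟨fun i j h => ?_, fun i => ?_⟩, ?_, ?_⟩
  · exact NontrivFact.deg_pos_map hl hF (Fin.rev_lt_rev.2 h)
  · exact NontrivFact.deg_pos_π hl hF _
  · exact NontrivFact.deg_pos_ι hl hF _
  · let θ : ∀ i : (Fin (m + 1))ᵒᵖ, op i.unop.rev.rev ≅ i := fun i =>
      eqToIso (congrArg op (Fin.rev_rev i.unop))
    refine ⟨FactChain.isoMk (fun i => Factorisation.forget.mapIso (F.mapIso (θ i)))
      (fun i => ?_) (fun i => Factorisation.Hom.h_π _) (fun {i j} g => ?_)⟩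
    · exact (congrArg (· ≫ (F.map (θ i).hom).h) (Factorisation.Hom.ι_h _)).trans
        (Factorisation.Hom.ι_h _)
    · exact congrArg Factorisation.Hom.h ((F.map_comp _ _).symm.trans
        ((congrArg F.map (Subsingleton.elim _ _)).trans (F.map_comp _ _)))

/-- The restriction of the factorization defined by a chain of arrows along the map that omits `j`
is the factorization defined by the face of the chain that omits `j.rev`. -/
theorem restrict_toFact_iso {m : ℕ} (K : ComposableArrows (Over w) (m + 1)) (f : v ⟶ K.left.left)
    {p : v ⟶ w} (h : f ≫ K.left.hom = p) (j i : Fin (m + 2)) (hi : j.rev = i)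
    (L : ComposableArrows (Over w) m)
    (β : faceFunctor i ⋙ K ≅ L) (f' : v ⟶ L.left.left) (h' : f' ≫ L.left.hom = p)
    (hβ : f ≫ (K.map (homOfLE (Fin.zero_le ((faceFunctor i).obj 0)))).left ≫
      (β.hom.app 0).left = f') :
    Nonempty ((Fin.succAboveOrderEmb j).monotone.functor.op ⋙ toFact K f h ≅ toFact L f' h') := by
  subst hi hβ
  let θ : ∀ i : (Fin (m + 1))ᵒᵖ, (j.succAbove i.unop).rev ≅ (faceFunctor j.rev).obj i.unop.rev :=
    fun i => eqToIso (Fin.rev_succAbove j i.unop)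
  let e : ∀ i : (Fin (m + 1))ᵒᵖ, K.obj (j.succAbove i.unop).rev ≅ L.obj i.unop.rev := fun i =>
    K.mapIso (θ i) ≪≫ β.app i.unop.rev
  refine ⟨FactChain.isoMk (fun i => (Over.forget w).mapIso (e i)) (fun i => ?_)
    (fun i => Over.w (e i).hom) (fun {a b} g => ?_)⟩
  · have e1 : K.map (homOfLE (Fin.zero_le (j.succAbove i.unop).rev)) ≫ (e i).hom =
        K.map (homOfLE (Fin.zero_le ((faceFunctor j.rev).obj 0))) ≫ β.hom.app 0 ≫
          L.map (homOfLE (Fin.zero_le i.unop.rev)) :=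
      ((Category.assoc _ _ _).symm.trans (congrArg (· ≫ β.hom.app i.unop.rev)
        ((K.map_comp _ _).symm.trans ((congrArg K.map (Subsingleton.elim _ _)).trans
          (K.map_comp (homOfLE (Fin.zero_le ((faceFunctor j.rev).obj 0)))
            ((faceFunctor j.rev).map (homOfLE (Fin.zero_le i.unop.rev)))))))).trans
        ((Category.assoc _ _ _).trans (congrArg (_ ≫ ·) (β.hom.naturality _)))
    change (f ≫ _) ≫ (e i).hom.left = (f ≫ _ ≫ _) ≫ _
    exact (Category.assoc _ _ _).trans ((congrArg (f ≫ ·) (congrArg CommaMorphism.left e1)).trans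
      (((congrArg (f ≫ ·) (Category.assoc _ _ _)).symm).trans (Category.assoc _ _ _).symm))
  · have hab : b.unop ≤ a.unop := leOfHom g.unop
    have e2 : K.map (homOfLE (Fin.rev_le_rev.2 ((Fin.succAboveOrderEmb j).monotone hab))) ≫
        (e b).hom = (e a).hom ≫ L.map (homOfLE (Fin.rev_le_rev.2 hab)) :=
      ((Category.assoc _ _ _).symm.trans (congrArg (· ≫ β.hom.app b.unop.rev)
        ((K.map_comp _ _).symm.trans ((congrArg K.map (Subsingleton.elim _ _)).trans
          (K.map_comp (θ a).hom
            ((faceFunctor j.rev).map (homOfLE (Fin.rev_le_rev.2 hab)))))))).trans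
        ((Category.assoc _ _ _).trans ((congrArg (_ ≫ ·) (β.hom.naturality _)).trans
          (Category.assoc _ _ _).symm))
    exact congrArg CommaMorphism.left e2

end ToFact

namespace BarChain

variable {C : Type u} [Category.{v} C] {l : CatGrading C} {R : ObjReps C} {v w : C}

theorem comp_toLeft {m : ℕ} {y z : C} (t : BarChain l R w (m + 1) y) {f : z ⟶ y} {p : z ⟶ w}
    (h : f ≫ t.comp = p) : (f ≫ t.toLeft) ≫ t.arrows.1.left.hom = p :=
  (Category.assoc _ _ _).trans ((congrArg (f ≫ ·) t.toLeft_hom).trans h)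

theorem deg_comp_toLeft_pos {m : ℕ} {y z : C} (t : BarChain l R w (m + 1) y) {f : z ⟶ y}
    (hf : 0 < l.deg f) : 0 < l.deg (f ≫ t.toLeft) := by
  rw [l.deg_comp]
  exact Nat.add_pos_left hf _

/-- The nontrivial factorization given by a reduced chain with at least two morphisms. -/
def toNontrivFact (hl : l.IsIndiscretelyBased) {m : ℕ} {p : v ⟶ w} :
    ∀ s : BarChain l R w (m + 2) v, s.comp = p → NontrivFact p m
  | cons t _ f hf, h => ⟨toFact t.arrows.1 (f ≫ t.toLeft) (t.comp_toLeft h),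
      toFact_isNontrivial hl t.arrowsNontrivial (t.deg_comp_toLeft_pos hf) _⟩

/-- The cell of the augmented semi-simplicial set of factorizations of `p` that is given by a
nonempty reduced chain with composite `p`. -/
def cell (hl : l.IsIndiscretelyBased) {p : v ⟶ w} : ∀ {m : ℕ} (s : BarChain l R w (m + 1) v),
    s.comp = p → (factSSet hl p).AugCell m
  | 0, _, _ => PUnit.unit
  | m + 1, s, h => (Quotient.mk (NontrivFact.setoid p m) (s.toNontrivFact hl h) :)

/-- Chains with the same cell are equal. As for the chains of arrows, this uses that representatives
have no automorphisms but the identity. -/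
theorem cell_injective (hl : l.IsIndiscretelyBased) {p : v ⟶ w} : ∀ {m : ℕ}
    {s s' : BarChain l R w (m + 1) v} {h : s.comp = p} {h' : s'.comp = p},
    s.cell hl h = s'.cell hl h' → s = s'
  | 0, cons nil hz f hf, cons nil hz' f' hf', h, h', _ => by
    rw [comp_cons, comp_nil, Category.comp_id] at h h'
    subst h h'
    rfl
  | m + 1, cons (y := y) t hz f hf, cons (y := y') t' hz' f' hf', h, h', e => by
    obtain ⟨β, hβ⟩ := (toFact_iso_iff (h := t.comp_toLeft h) (h' := t'.comp_toLeft h')).1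
      (Quotient.exact e)
    obtain rfl : y = y' := by
      have e : y ≅ y' := asIso t.toLeft ≪≫ (Over.forget w).mapIso (β.app 0) ≪≫
        (asIso t'.toLeft).symm
      rw [← t.rep_eq, ← t'.rep_eq, R.rep_eq e]
    obtain rfl := eq_of_arrows_iso hl t t' β
    have h2 : (β.app 0).hom.left = 𝟙 t.arrows.1.left.left :=
      hl.hom_eq (CatGrading.deg_of_isIso ((Over.forget w).mapIso (β.app 0)).hom) (l.deg_id _)
    have h3 : (f ≫ t.toLeft) ≫ (β.app 0).hom.left = f' ≫ t.toLeft := hβ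
    rw [h2] at h3
    have h4 : (f ≫ t.toLeft) ≫ 𝟙 _ = f' ≫ t.toLeft := h3
    rw [Category.comp_id, cancel_mono] at h4
    subst h4
    rfl

/-- Every cell is given by a chain, if `v` is its own representative and `p` is not an
isomorphism. -/
theorem exists_cell_eq (hl : l.IsIndiscretelyBased) (hv : R.rep v = v) {p : v ⟶ w}
    (hp : 0 < l.deg p) : ∀ {m : ℕ} (x : (factSSet hl p).AugCell m),
    ∃ (s : BarChain l R w (m + 1) v) (h : s.comp = p), s.cell hl h = x
  | 0, _ => ⟨cons nil hv p hp, Category.comp_id p, rfl⟩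
  | m + 1, x => by
    obtain ⟨⟨F, hF⟩, rfl⟩ := Quotient.exists_rep (s := NontrivFact.setoid p m) x
    obtain ⟨K, f, h, hK, hf, ⟨e⟩⟩ := exists_toFact_iso F hF hl
    obtain ⟨y, t, ⟨β⟩⟩ := exists_arrows_iso R K hK
    let g : v ⟶ t.arrows.1.left.left := f ≫ (β.hom.app 0).left
    have hg : 0 < l.deg (g ≫ t.fromLeft) := by
      rw [l.deg_comp]
      exact Nat.add_pos_left ((Nat.add_pos_left hf _).trans_eq (l.deg_comp _ _).symm) _
    have hg' : g ≫ t.arrows.1.left.hom = p :=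
      (Category.assoc _ _ _).trans ((congrArg (f ≫ ·) (Over.w (β.hom.app 0))).trans h)
    have hgt : g = (g ≫ t.fromLeft) ≫ t.toLeft := by simp
    refine ⟨cons t hv (g ≫ t.fromLeft) hg, by simpa using hg', Quotient.sound ?_⟩
    obtain ⟨e'⟩ := toFact_iso_iff (h := h) (h' := t.comp_toLeft (by simpa using hg')) |>.2 ⟨β, hgt⟩
    exact ⟨e'.symm ≪≫ e⟩

/-- The faces of a cell are the cells of the inner faces, in the reverse order. -/
theorem augFace_cell (hl : l.IsIndiscretelyBased) {p : v ⟶ w} : ∀ {m : ℕ}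
    (s : BarChain l R w (m + 2) v) (h : s.comp = p) (j : Fin (m + 1)),
    (factSSet hl p).augFace m j (s.cell hl h) =
      (s.face j.rev).cell hl ((s.comp_face _).trans h)
  | 0, _, _, _ => rfl
  | m + 1, cons t hz f hf, h, j => by
    refine Quotient.sound (s := NontrivFact.setoid p m) ?_
    generalize hi : j.rev = i
    induction i using Fin.cases with
    | zero =>
      cases t with
      | cons t hy g hg =>
        refine restrict_toFact_iso _ _ (comp_toLeft _ h) j 0 hi t.arrows.1
          (faceZeroIso _) ((f ≫ g) ≫ t.toLeft)
          (t.comp_toLeft ((Category.assoc f g _).trans h)) ?_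
        have e := congrArg CommaMorphism.left (map_faceZeroIso (cons t hy g hg).arrows.1)
        refine (congrArg ((f ≫ (cons t hy g hg).toLeft) ≫ ·) e).trans ?_
        change (f ≫ 𝟙 _) ≫ g ≫ t.toLeft = _
        simp
    | succ i =>
      obtain ⟨β, hβ⟩ := exists_face_iso t i
      refine restrict_toFact_iso _ _ (t.comp_toLeft h) j i.succ hi (t.face i).arrows.1 β
        (f ≫ (t.face i).toLeft) ((t.face i).comp_toLeft
          ((congrArg (f ≫ ·) (t.comp_face i)).trans h)) ?_
      exact (Category.assoc _ _ _).trans (congrArg (f ≫ ·) hβ)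

end BarChain

/-! ### Cochains on the bar resolution -/

namespace GrMod

variable {k : Type w} [Field k] {C : Type u} [Category.{v} C] {l : CatGrading C} {R : ObjReps C}
  {v w : C}

/-- The coordinate at `v` of the value of a homomorphism to `S_v(-n)` on the generator of the bar
resolution given by a chain of length `n` that starts at `v`. -/
def barEval (k : Type w) [Field k] (hl : l.IsIndiscretelyBased) {n : ℤ} {r : ℕ}
    (s : BarChain l R w r v) (hs : (l.deg s.comp : ℤ) = n) :
    (barMod k R w l r ⟶ (simple k hl v).shift (-n)) →ₗ[k] k where
  toFun φ := simpleCoord k hl (j := -n + n) ⟨Iso.refl v⟩ (neg_add_cancel n)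
    (φ.app n (bas k s (𝟙 v) (by rw [l.deg_id, hs]; simp)))
  map_add' _ _ := rfl
  map_smul' _ _ := rfl

theorem barEval_congr (hl : l.IsIndiscretelyBased) {n : ℤ} {r : ℕ} {s s' : BarChain l R w r v}
    (h : s = s') (hs : (l.deg s.comp : ℤ) = n)
    (φ : barMod k R w l r ⟶ (simple k hl v).shift (-n)) :
    barEval k hl s hs φ = barEval k hl s' (by rw [← h, hs]) φ := by
  subst h
  rfl

/-- The coboundary of a cochain: the term of the differential that multiplies a shorter chain by
its first morphism does not contribute, since morphisms of positive length annihilate `S_v`. -/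
theorem barEval_barD (hl : l.IsIndiscretelyBased) {n : ℤ} {r : ℕ} (s : BarChain l R w (r + 1) v)
    (hs : (l.deg s.comp : ℤ) = n) (φ : barMod k R w l r ⟶ (simple k hl v).shift (-n)) :
    barEval k hl s hs (barD k l R w r ≫ φ) = ∑ i : Fin r, (-1 : k) ^ ((i : ℕ) + 1) *
      barEval k hl (s.face i) (by rw [s.comp_face, hs]) φ := by
  cases s with
  | @cons _ y _ s hz f hf =>
    have h0 : (l.deg s.comp : ℤ) + l.deg f = n := by
      rw [← hs, BarChain.comp_cons, l.deg_comp]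
      push_cast
      omega
    have h1 : bas k s (𝟙 v ≫ f) (j := n) (by rw [Category.id_comp, h0]) =
        (barMod k R w l r).rmul f h0 (bas k s (𝟙 y) (by rw [l.deg_id]; simp)) := by
      rw [rmul_bas]
      exact bas_congr _ rfl (by simp)
    have h2 : φ.app n (bas k s (𝟙 v ≫ f) (j := n) (by rw [Category.id_comp, h0])) = 0 := by
      rw [h1, Hom.app_rmul, shift_rmul]
      exact simple_rmul_of_pos hl v f hf _ _
    refine (congrArg (fun a => simpleCoord k hl (j := -n + n) ⟨Iso.refl v⟩ (neg_add_cancel n)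
      (φ.app n a)) (barD_bas s hz f hf (𝟙 v) _)).trans ?_
    rw [map_add, h2, zero_add, map_sum]
    refine (map_sum (simpleCoord k hl (c := v) (j := -n + n) ⟨Iso.refl v⟩ (neg_add_cancel n))
      _ _).trans (Finset.sum_congr rfl fun i _ => ?_)
    rw [map_smul]
    rfl

/-- The chain that gives a cell. -/
def chainOfCell (hl : l.IsIndiscretelyBased) (hv : R.rep v = v) {p : v ⟶ w} (hp : 0 < l.deg p)
    {m : ℕ} (x : (factSSet hl p).AugCell m) : BarChain l R w (m + 1) v :=
  (BarChain.exists_cell_eq hl hv hp x).choose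

theorem comp_chainOfCell (hl : l.IsIndiscretelyBased) (hv : R.rep v = v) {p : v ⟶ w}
    (hp : 0 < l.deg p) {m : ℕ} (x : (factSSet hl p).AugCell m) :
    (chainOfCell hl hv hp x).comp = p :=
  (BarChain.exists_cell_eq hl hv hp x).choose_spec.choose

theorem cell_chainOfCell (hl : l.IsIndiscretelyBased) (hv : R.rep v = v) {p : v ⟶ w}
    (hp : 0 < l.deg p) {m : ℕ} (x : (factSSet hl p).AugCell m) :
    (chainOfCell hl hv hp x).cell hl (comp_chainOfCell hl hv hp x) = x :=
  (BarChain.exists_cell_eq hl hv hp x).choose_spec.choose_spec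

theorem chainOfCell_cell (hl : l.IsIndiscretelyBased) (hv : R.rep v = v) {p : v ⟶ w}
    (hp : 0 < l.deg p) {m : ℕ} (s : BarChain l R w (m + 1) v) (h : s.comp = p) :
    chainOfCell hl hv hp (s.cell hl h) = s :=
  BarChain.cell_injective hl (cell_chainOfCell hl hv hp (s.cell hl h))

/-- The cochains on the augmented semi-simplicial sets of factorizations of the morphisms `v ⟶ w`
of length `n` that are given by a homomorphism from the bar resolution to `S_v(-n)`. -/
def cochain (k : Type w) [Field k] (hl : l.IsIndiscretelyBased) (hv : R.rep v = v) {n : ℤ}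
    (hn : n ≠ 0) (m : ℕ) :
    (barMod k R w l (m + 1) ⟶ (simple k hl v).shift (-n)) →ₗ[k]
      ((p : {p : v ⟶ w // (l.deg p : ℤ) = n}) → (factSSet hl p.1).AugCell m → k) :=
  LinearMap.pi fun p => LinearMap.pi fun x =>
    have hp : 0 < l.deg p.1 := by have := p.2; omega
    barEval k hl (chainOfCell hl hv hp x) (by rw [comp_chainOfCell, p.2])

theorem cochain_cell (hl : l.IsIndiscretelyBased) (hv : R.rep v = v) {n : ℤ}
    (hn : n ≠ 0) (m : ℕ) (φ : barMod k R w l (m + 1) ⟶ (simple k hl v).shift (-n))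
    (p : {p : v ⟶ w // (l.deg p : ℤ) = n}) (s : BarChain l R w (m + 1) v) (h : s.comp = p.1) :
    cochain k hl hv hn m φ p (s.cell hl h) = barEval k hl s (by rw [h, p.2]) φ := by
  have e := chainOfCell_cell hl hv (by have := p.2; omega) s h
  exact barEval_congr hl e (by rw [comp_chainOfCell, p.2]) φ

/-- The chains of length `n` from an object isomorphic to `v`, hence from `v`, are in bijection with
the cells, so homomorphisms to `S_v(-n)` and cochains agree. -/
theorem cochain_bijective (hl : l.IsIndiscretelyBased) (hv : R.rep v = v) {n : ℤ}
    (hn : n ≠ 0) (m : ℕ) : Function.Bijective (cochain (w := w) k hl hv hn m) := by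
  let T := {t : Σ z, BarChain l R w (m + 1) z // Nonempty (t.1 ≅ v) ∧ (l.deg t.2.comp : ℤ) = n}
  have hp : ∀ p : {p : v ⟶ w // (l.deg p : ℤ) = n}, 0 < l.deg p.1 := fun p => by
    have := p.2
    omega
  let g : (Σ p : {p : v ⟶ w // (l.deg p : ℤ) = n}, (factSSet hl p.1).AugCell m) → T := fun q =>
    ⟨⟨v, chainOfCell hl hv (hp q.1) q.2⟩, ⟨Iso.refl v⟩, by rw [comp_chainOfCell, q.1.2]⟩
  have hg : Function.Bijective g := by
    constructor
    · rintro ⟨⟨p, hpn⟩, x⟩ ⟨⟨p', hpn'⟩, x'⟩ h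
      have h1 : chainOfCell hl hv (hp ⟨p, hpn⟩) x = chainOfCell hl hv (hp ⟨p', hpn'⟩) x' :=
        eq_of_heq (Sigma.ext_iff.1 (Subtype.ext_iff.1 h)).2
      obtain rfl : p = p' := (comp_chainOfCell hl hv (hp ⟨p, hpn⟩) x).symm.trans
        ((congrArg BarChain.comp h1).trans (comp_chainOfCell hl hv (hp ⟨p', hpn'⟩) x'))
      have h2 := cell_chainOfCell hl hv (hp ⟨p, hpn⟩) x
      simp only [h1, cell_chainOfCell] at h2
      rw [h2]
    · rintro ⟨⟨z, s⟩, ⟨e⟩, h⟩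
      obtain rfl : z = v := by rw [← s.rep_eq, ← hv, R.rep_eq e, hv]
      refine ⟨⟨⟨s.comp, h⟩, s.cell hl rfl⟩, Subtype.ext ?_⟩
      exact congrArg (Sigma.mk z) (chainOfCell_cell hl hv _ s rfl)
  have hc : ∀ φ p x, cochain k hl hv hn m φ p x =
      freeHomCoord k hl _ _ v n φ (g ⟨p, x⟩) := fun _ _ _ => rfl
  constructor
  · intro φ φ' h
    refine freeHomCoord_injective hl v n (funext fun t => ?_)
    obtain ⟨⟨p, x⟩, rfl⟩ := hg.2 t
    rw [← hc, ← hc, h]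
  · intro ψ
    let E := Equiv.ofBijective g hg
    obtain ⟨φ, hφ⟩ := freeHomCoord_surjective (k := k) hl v n
      (fun t : T => ψ (E.symm t).1 (E.symm t).2)
    refine ⟨φ, funext fun p => funext fun x => ?_⟩
    rw [hc, hφ]
    exact congrArg (fun q : Σ p : {p : v ⟶ w // (l.deg p : ℤ) = n},
      (factSSet hl p.1).AugCell m => ψ q.1 q.2) (E.symm_apply_apply ⟨p, x⟩)

/-- The differentials agree up to a sign, which comes from the reversed numbering of the faces and
from the outer term of the differential of the bar resolution. -/
theorem cochain_barD (hl : l.IsIndiscretelyBased) (hv : R.rep v = v) {n : ℤ}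
    (hn : n ≠ 0) (m : ℕ) (φ : barMod k R w l (m + 1) ⟶ (simple k hl v).shift (-n))
    (p : {p : v ⟶ w // (l.deg p : ℤ) = n}) :
    cochain k hl hv hn (m + 1) (barD k l R w (m + 1) ≫ φ) p =
      (-1 : k) ^ (m + 1) • SemiSSet.augD k (factSSet hl p.1) m (cochain k hl hv hn m φ p) := by
  have hp : 0 < l.deg p.1 := by have := p.2; omega
  funext x
  obtain ⟨s, h, rfl⟩ := BarChain.exists_cell_eq hl hv hp x
  rw [cochain_cell, barEval_barD, Pi.smul_apply, SemiSSet.augD_apply, smul_eq_mul, Finset.mul_sum]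
  refine Fintype.sum_equiv Fin.revPerm _ _ fun i => ?_
  rw [BarChain.augFace_cell, cochain_cell]
  have h1 : (-1 : k) ^ ((i : ℕ) + 1) =
      (-1) ^ (m + 1) * (-1) ^ ((Fin.revPerm i : Fin (m + 1)) : ℕ) := by
    have h2 : m + 1 + ((Fin.revPerm i : Fin (m + 1)) : ℕ) + 2 * i = (i + 1) + 2 * m := by
      simp only [Fin.revPerm_apply, Fin.val_rev]
      omega
    have h3 : ∀ j : ℕ, (-1 : k) ^ (2 * j) = 1 := fun j => by rw [pow_mul, neg_one_sq, one_pow]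
    calc (-1 : k) ^ ((i : ℕ) + 1) = (-1) ^ ((i : ℕ) + 1 + 2 * m) := by
          rw [pow_add _ _ (2 * m), h3, mul_one]
      _ = _ := by rw [← h2, pow_add _ _ (2 * (i : ℕ)), h3, mul_one, pow_add]
  rw [h1, mul_assoc]
  simp only [Fin.revPerm_apply, Fin.rev_rev]

end GrMod

/-! ### Reduced cohomology in terms of cocycles -/

/-- The homology of a short complex of modules is the quotient of the kernel by the image. -/
theorem exists_ker_to_homology {k : Type*} [Field k] (S : ShortComplex (ModuleCat k)) :
    ∃ π : LinearMap.ker S.g.hom →ₗ[k] S.homology, Function.Surjective π ∧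
      ∀ x, π x = 0 ↔ ∃ y, S.f y = x.1 := by
  let e : S.homology ≃ₗ[k] (LinearMap.ker S.g.hom ⧸ LinearMap.range S.moduleCatToCycles) :=
    S.moduleCatHomologyIso.toLinearEquiv
  refine ⟨e.symm.toLinearMap.comp (LinearMap.range S.moduleCatToCycles).mkQ,
    e.symm.surjective.comp (Submodule.mkQ_surjective _), fun x => ?_⟩
  refine e.symm.map_eq_zero_iff.trans ((Submodule.Quotient.mk_eq_zero _).trans ?_)
  exact ⟨fun ⟨y, hy⟩ => ⟨y, congrArg Subtype.val hy⟩, fun ⟨y, hy⟩ => ⟨y, Subtype.ext hy⟩⟩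

namespace SemiSSet

variable (k : Type w) [Field k] (K : SemiSSet.{u})

theorem augComplex_d (m : ℕ) :
    (augComplex k K).d m (m + 1) = ModuleCat.ofHom (augD k K m) :=
  CochainComplex.of_d (fun m => ModuleCat.of k (K.AugCell m → k))
    (fun m => ModuleCat.ofHom (augD k K m)) m

/-- The reduced cohomology is the quotient of the cocycles by the coboundaries. The functions on the
cells of dimension `m - 1` are in degree `m` of `augComplex`. -/
theorem exists_ker_to_redCohomology (m : ℕ) (j : ℤ) (hj : j = m - 1) :
    ∃ π : LinearMap.ker (augD k K m) →ₗ[k] redCohomology k K j, Function.Surjective π ∧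
      ∀ x, π x = 0 ↔ ∃ y : (augComplex k K).X ((ComplexShape.up ℕ).prev m),
        (augComplex k K).d _ m y = x.1 := by
  obtain ⟨π, hπ, h⟩ := exists_ker_to_homology ((augComplex k K).sc m)
  let e : redCohomology k K j ≃ₗ[k] (augComplex k K).homology m :=
    ((augComplex k K).extendHomologyIso (ComplexShape.embeddingUpIntGE (-1)) (j := m) (by
      change -1 + (m : ℤ) = j
      omega)).toLinearEquiv
  have hker : ∀ x : K.AugCell m → k, x ∈ LinearMap.ker (augD k K m) ↔
      x ∈ LinearMap.ker ((augComplex k K).sc m).g.hom := by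
    intro x
    have h1 : (ComplexShape.up ℕ).next m = m + 1 := by simp
    change _ ↔ ((augComplex k K).d m ((ComplexShape.up ℕ).next m)).hom x = 0
    rw [h1, augComplex_d]
    rfl
  let ι : LinearMap.ker (augD k K m) ≃ₗ[k] LinearMap.ker ((augComplex k K).sc m).g.hom :=
    { toFun := fun x => ⟨x.1, (hker _).1 x.2⟩
      invFun := fun x => ⟨x.1, (hker _).2 x.2⟩
      map_add' := fun _ _ => rfl
      map_smul' := fun _ _ => rfl }
  refine ⟨e.symm.toLinearMap.comp (π.comp ι.toLinearMap),
    e.symm.surjective.comp (hπ.comp ι.surjective), fun x => ?_⟩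
  exact e.symm.map_eq_zero_iff.trans (h _)

theorem exists_ker_to_redCohomology_zero (j : ℤ) (hj : j = -1) :
    ∃ π : LinearMap.ker (augD k K 0) →ₗ[k] redCohomology k K j, Function.Bijective π := by
  obtain ⟨π, hπ, h⟩ := exists_ker_to_redCohomology k K 0 j (by simpa using hj)
  refine ⟨π, (injective_iff_map_eq_zero π).2 fun x hx => ?_, hπ⟩
  obtain ⟨y, hy⟩ := (h x).1 hx
  rw [(augComplex k K).shape _ _ (by simp)] at hy
  exact Subtype.ext hy.symm

theorem exists_ker_to_redCohomology_succ (m : ℕ) (j : ℤ) (hj : j = m) :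
    ∃ π : LinearMap.ker (augD k K (m + 1)) →ₗ[k] redCohomology k K j, Function.Surjective π ∧
      ∀ x, π x = 0 ↔ ∃ y, augD k K m y = x.1 := by
  obtain ⟨π, hπ, h⟩ := exists_ker_to_redCohomology k K (m + 1) j (by simpa using hj)
  refine ⟨π, hπ, fun x => (h x).trans ?_⟩
  have h1 : (ComplexShape.up ℕ).prev (m + 1) = m := by simp
  rw [h1, augComplex_d]
  rfl

theorem subsingleton_redCohomology {j : ℤ} (hj : j < -1) :
    Subsingleton (redCohomology k K j) :=
  ModuleCat.subsingleton_of_isZero ((HomologicalComplex.exactAt_iff_isZero_homology _ _).1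
    (HomologicalComplex.extend_exactAt _ _ _
      ((ComplexShape.notMem_range_embeddingUpIntGE_iff _ _).2 hj)))

end SemiSSet

/-! ### Extensions of simple modules -/

/-- Two quotients of a vector space by the same subspace are isomorphic. -/
theorem nonempty_linearEquiv_of_surjective {k V A B : Type*} [Field k] [AddCommGroup V] [Module k V]
    [AddCommGroup A] [Module k A] [AddCommGroup B] [Module k B] (q : V →ₗ[k] A)
    (hq : Function.Surjective q) (f : V →ₗ[k] B) (hf : Function.Surjective f)
    (h : ∀ x, q x = 0 ↔ f x = 0) : Nonempty (A ≃ₗ[k] B) :=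
  ⟨(q.quotKerEquivOfSurjective hq).symm ≪≫ₗ
    Submodule.quotEquivOfEq _ (LinearMap.ker f) (Submodule.ext fun x => h x) ≪≫ₗ
    f.quotKerEquivOfSurjective hf⟩

/-- A product with only finitely many nonzero factors is a direct sum. -/
theorem nonempty_pi_linearEquiv_directSum {k ι : Type*} [Field k] {M : ι → Type*}
    [∀ i, AddCommGroup (M i)] [∀ i, Module k (M i)] (h : {i | Nontrivial (M i)}.Finite) :
    Nonempty ((∀ i, M i) ≃ₗ[k] DirectSum ι M) := by
  classical
  let e : (Π₀ i, M i) →ₗ[k] ∀ i, M i := DFinsupp.coeFnLinearMap k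
  refine ⟨(LinearEquiv.ofBijective e ⟨DFunLike.coe_injective, fun f =>
    ⟨DFinsupp.mk h.toFinset fun i => f i, funext fun i => ?_⟩⟩).symm⟩
  by_cases hi : i ∈ h.toFinset
  · simp [e, DFinsupp.mk_apply, hi]
  · have : Subsingleton (M i) := not_nontrivial_iff_subsingleton.1 fun q =>
      hi (h.mem_toFinset.2 q)
    exact Subsingleton.elim _ _

namespace GrMod

variable {k : Type w} [Field k] {C : Type u} [Category.{v} C] {l : CatGrading C} {R : ObjReps C}
  {v w : C}

/-- Extensions are the quotient of the cocycles by the coboundaries in the complex of homomorphisms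
from the bar resolution. -/
theorem exists_ker_to_ext (hl : l.IsIndiscretelyBased) (R : ObjReps C) (w : C)
    (N : GrMod.{w, v, u} k l) (m : ℕ) :
    ∃ q : LinearMap.ker (Linear.leftComp k N (barD k l R w (m + 1))) →ₗ[k]
        Abelian.Ext (simple k hl w) N (m + 1), Function.Surjective q ∧
      ∀ φ, q φ = 0 ↔ ∃ ψ : barMod k R w l m ⟶ N, barD k l R w m ≫ ψ = φ.1 := by
  have h := barResolution_d k hl R w
  let ι : LinearMap.ker (Linear.leftComp k N (barD k l R w (m + 1))) ≃ₗ[k]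
      LinearMap.ker (Linear.leftComp k N ((barResolution k hl R w).complex.d (m + 2) (m + 1))) :=
    { toFun := fun φ => ⟨φ.1, (congrArg (· ≫ φ.1) (h (m + 1))).trans φ.2⟩
      invFun := fun φ => ⟨φ.1, (congrArg (· ≫ φ.1) (h (m + 1))).symm.trans φ.2⟩
      map_add' := fun _ _ => rfl
      map_smul' := fun _ _ => rfl }
  refine ⟨(extOfCocycle k (barResolution k hl R w) N (m + 1)).comp ι.toLinearMap,
    (extOfCocycle_surjective k _ N (m + 1)).comp ι.surjective, fun φ => ?_⟩
  refine (extOfCocycle_eq_zero_iff k (barResolution k hl R w) N m (ι φ)).trans ?_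
  exact exists_congr fun ψ => ⟨fun q => (congrArg (· ≫ ψ) (h m)).symm.trans q,
    fun q => (congrArg (· ≫ ψ) (h m)).trans q⟩

/-- There are no homomorphisms to `S_v(-n)` from a free module without generators of degree `n` at
the objects isomorphic to `v`. -/
theorem free_hom_eq_zero (hl : l.IsIndiscretelyBased) {T : Type (max u v)} {c : T → C} {d : T → ℤ}
    {n : ℤ} (h : ∀ t, Nonempty (c t ≅ v) → d t ≠ n)
    (φ : freeMod k l c d ⟶ (simple k hl v).shift (-n)) : φ = 0 :=
  freeHomCoord_injective hl v n (funext fun t => absurd t.2.2 (h _ t.2.1))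

theorem bar_zero_hom_eq_zero (hl : l.IsIndiscretelyBased) {n : ℤ} (hn : n ≠ 0)
    (φ : barMod k R w l 0 ⟶ (simple k hl v).shift (-n)) : φ = 0 :=
  free_hom_eq_zero hl (by
    rintro ⟨_, ⟨⟩⟩ _
    rw [BarChain.comp_nil, l.deg_id]
    exact hn.symm) φ

theorem bar_succ_hom_eq_zero (hl : l.IsIndiscretelyBased) {n : ℤ} (hn : n = 0) {m : ℕ}
    (φ : barMod k R w l (m + 1) ⟶ (simple k hl v).shift (-n)) : φ = 0 :=
  free_hom_eq_zero hl (fun t _ => by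
    have := t.2.deg_comp_pos
    omega) φ

/-- If there are no homomorphisms from the term of the bar resolution in homological degree one,
then every homomorphism from the term in degree zero factors through the augmentation. -/
theorem ext_zero_equiv_hom (hl : l.IsIndiscretelyBased) (R : ObjReps C) (w : C)
    (N : GrMod.{w, v, u} k l) (hN : ∀ φ : barMod k R w l 1 ⟶ N, φ = 0) :
    Nonempty (Abelian.Ext (simple k hl w) N 0 ≃ₗ[k] (barMod k R w l 0 ⟶ N)) := by
  refine ⟨Abelian.Ext.linearEquiv₀ (R := k) ≪≫ₗ
    LinearEquiv.ofBijective (Linear.leftComp k N (barAug k hl R w)) ⟨fun f g h => ?_, fun φ => ?_⟩⟩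
  · exact (cancel_epi (barAug k hl R w)).1 h
  · let c := (exact_barAug (k := k) (R := R) (w := w) hl).gIsCokernel
    exact ⟨c.desc (CokernelCofork.ofπ φ (hN _)), c.fac _ WalkingParallelPair.one⟩

theorem subsingleton_ext_zero (hl : l.IsIndiscretelyBased) (R : ObjReps C) (w : C)
    (N : GrMod.{w, v, u} k l) (hN : ∀ φ : barMod k R w l 0 ⟶ N, φ = 0) :
    Subsingleton (Abelian.Ext (simple k hl w) N 0) :=
  (Abelian.Ext.linearEquiv₀ (R := k)).toEquiv.subsingleton_congr.2
    ⟨fun _ _ => (cancel_epi (barAug k hl R w)).1 ((hN _).trans (hN _).symm)⟩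

/-- The extensions are a product of spaces `H p`, if each `H p` is the quotient of the cocycles on
the factorizations of `p` by those that satisfy `B p`, and the coboundaries on the bar resolution are
the cochains all of whose components satisfy `B p`. -/
theorem nonempty_ext_succ_equiv (hl : l.IsIndiscretelyBased) (hv : R.rep v = v) {n : ℤ}
    (hn : n ≠ 0) (m : ℕ) {H : {p : v ⟶ w // (l.deg p : ℤ) = n} → Type*}
    [∀ p, AddCommGroup (H p)] [∀ p, Module k (H p)]
    (π : ∀ p, LinearMap.ker (SemiSSet.augD k (factSSet hl p.1) m) →ₗ[k] H p)
    (hπ : ∀ p, Function.Surjective (π p))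
    (B : ∀ p, ((factSSet hl p.1).AugCell m → k) → Prop) (hB : ∀ p x, π p x = 0 ↔ B p x.1)
    (hcob : ∀ φ : barMod k R w l (m + 1) ⟶ (simple k hl v).shift (-n),
      (∃ ψ, barD k l R w m ≫ ψ = φ) ↔ ∀ p, B p (cochain k hl hv hn m φ p)) :
    Nonempty (GrExt (simple k hl w) (simple k hl v) (m + 1) (-n) ≃ₗ[k] (∀ p, H p)) := by
  obtain ⟨q, hq, hq0⟩ := exists_ker_to_ext hl R w ((simple k hl v).shift (-n)) m
  have hcoc : ∀ φ : barMod k R w l (m + 1) ⟶ (simple k hl v).shift (-n),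
      barD k l R w (m + 1) ≫ φ = 0 ↔
        ∀ p, SemiSSet.augD k (factSSet hl p.1) m (cochain k hl hv hn m φ p) = 0 := fun φ => by
    rw [← map_eq_zero_iff _ (cochain_bijective hl hv hn (m + 1)).1, funext_iff]
    refine forall_congr' fun p => ?_
    rw [cochain_barD, Pi.zero_apply, smul_eq_zero_iff_right (pow_ne_zero _ (by simp))]
  let f : LinearMap.ker (Linear.leftComp k ((simple k hl v).shift (-n)) (barD k l R w (m + 1)))
      →ₗ[k] (∀ p, H p) :=
    LinearMap.pi fun p => (π p).comp (LinearMap.codRestrict _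
      ((LinearMap.proj p).comp ((cochain k hl hv hn m).comp (Submodule.subtype _)))
      fun φ => (hcoc φ.1).1 φ.2 p)
  refine nonempty_linearEquiv_of_surjective q hq f (fun y => ?_) fun φ => ?_
  · choose x hx using fun p => hπ p (y p)
    obtain ⟨φ, hφ⟩ := (cochain_bijective hl hv hn m).2 fun p => (x p).1
    refine ⟨⟨φ, (hcoc φ).2 fun p => ?_⟩, funext fun p => ?_⟩
    · rw [hφ]
      exact (x p).2
    · rw [← hx p]
      exact congrArg (π p) (Subtype.ext (congrFun hφ p))
  · rw [hq0, hcob, funext_iff]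
    exact forall_congr' fun p =>
      (hB p ⟨cochain k hl hv hn m φ.1 p, (hcoc φ.1).1 φ.2 p⟩).symm

/-- The extensions in positive homological and nonzero internal degree. -/
theorem ext_succ_equiv (hl : l.IsIndiscretelyBased) (v w : C) {n : ℤ} (hn : n ≠ 0) (m : ℕ) {j : ℤ}
    (hj : j = m - 1) :
    Nonempty (GrExt (simple k hl w) (simple k hl v) (m + 1) (-n) ≃ₗ[k]
      ((p : {p : v ⟶ w // (l.deg p : ℤ) = n}) →
        SemiSSet.redCohomology k (factSSet hl p.1) j)) := by
  obtain ⟨R, hv⟩ := ObjReps.exists_rep_eq v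
  cases m with
  | zero =>
    choose π hπ using fun p : {p : v ⟶ w // (l.deg p : ℤ) = n} =>
      SemiSSet.exists_ker_to_redCohomology_zero k (factSSet hl p.1) j (by simpa using hj)
    refine nonempty_ext_succ_equiv hl hv hn 0 π (fun p => (hπ p).2) (fun _ x => x = 0)
      (fun p x => (map_eq_zero_iff _ (hπ p).1).trans Subtype.ext_iff) fun φ => ?_
    -- There are no coboundaries on either side.
    have h : (∃ ψ, barD k l R w 0 ≫ ψ = φ) ↔ φ = 0 :=
      ⟨fun ⟨ψ, hψ⟩ => by rw [← hψ, bar_zero_hom_eq_zero hl hn ψ, comp_zero],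
        fun h => ⟨0, by rw [h, comp_zero]⟩⟩
    rw [h, ← map_eq_zero_iff _ (cochain_bijective hl hv hn 0).1, funext_iff]
    rfl
  | succ m =>
    choose π hπ hπ0 using fun p : {p : v ⟶ w // (l.deg p : ℤ) = n} =>
      SemiSSet.exists_ker_to_redCohomology_succ k (factSSet hl p.1) m j (by simpa using hj)
    have hs : (-1 : k) ^ (m + 1) * (-1) ^ (m + 1) = 1 := by
      rw [← mul_pow, neg_mul_neg, one_mul, one_pow]
    refine nonempty_ext_succ_equiv hl hv hn (m + 1) π hπ
      (fun p x => ∃ y, SemiSSet.augD k (factSSet hl p.1) m y = x) hπ0 fun φ =>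
      ⟨?_, fun h => ?_⟩
    · rintro ⟨ψ, rfl⟩ p
      exact ⟨(-1 : k) ^ (m + 1) • cochain k hl hv hn m ψ p, by rw [map_smul, cochain_barD]⟩
    · choose y hy using h
      obtain ⟨ψ, hψ⟩ := (cochain_bijective hl hv hn m).2 fun p => (-1 : k) ^ (m + 1) • y p
      refine ⟨ψ, (cochain_bijective hl hv hn (m + 1)).1 (funext fun p => ?_)⟩
      rw [cochain_barD, hψ, map_smul, smul_smul, hs, one_smul, hy]

/-- The extensions in nonzero internal degree. In homological degree zero both sides vanish, as the
reduced cohomology in degree `-2` does. -/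
theorem ext_equiv (hl : l.IsIndiscretelyBased) (v w : C) {n : ℤ} (hn : n ≠ 0) (i : ℕ) :
    Nonempty (GrExt (simple k hl w) (simple k hl v) i (-n) ≃ₗ[k]
      ((p : {p : v ⟶ w // (l.deg p : ℤ) = n}) →
        SemiSSet.redCohomology k (factSSet hl p.1) ((i : ℤ) - 2))) := by
  cases i with
  | zero =>
    obtain ⟨R, -⟩ := ObjReps.exists_rep_eq v
    have := subsingleton_ext_zero hl R w ((simple k hl v).shift (-n)) (bar_zero_hom_eq_zero hl hn)
    have := fun p : {p : v ⟶ w // (l.deg p : ℤ) = n} =>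
      SemiSSet.subsingleton_redCohomology k (factSSet hl p.1) (j := ((0 : ℕ) : ℤ) - 2) (by simp)
    exact ⟨LinearEquiv.ofSubsingleton _ _⟩
  | succ m => exact ext_succ_equiv hl v w hn m (by push_cast; ring)

theorem ext_zero_deg_zero_equiv (hl : l.IsIndiscretelyBased) {v w : C} (e : v ≅ w) {n : ℤ}
    (hn : n = 0) :
    Nonempty (GrExt (simple k hl w) (simple k hl v) 0 (-n) ≃ₗ[k] k) := by
  obtain ⟨R, -⟩ := ObjReps.exists_rep_eq v
  obtain ⟨E⟩ := ext_zero_equiv_hom hl R w ((simple k hl v).shift (-n))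
    (bar_succ_hom_eq_zero hl hn)
  let T := {t : Σ z, BarChain l R w 0 z // Nonempty (t.1 ≅ v) ∧ (l.deg t.2.comp : ℤ) = n}
  have : Unique T :=
    { default := ⟨⟨w, .nil⟩, ⟨e.symm⟩, by rw [BarChain.comp_nil, l.deg_id, hn]; rfl⟩
      uniq := by
        rintro ⟨⟨_, ⟨⟩⟩, _⟩
        rfl }
  exact ⟨E ≪≫ₗ LinearEquiv.ofBijective (freeHomCoord k hl _ _ v n)
    ⟨freeHomCoord_injective hl v n, freeHomCoord_surjective hl v n⟩ ≪≫ₗ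
    LinearEquiv.funUnique T k k⟩

theorem subsingleton_ext_deg_zero (hl : l.IsIndiscretelyBased) {v w : C} {i : ℕ} {n : ℤ}
    (hn : n = 0) (h : ¬ (i = 0 ∧ Nonempty (v ≅ w))) :
    Subsingleton (GrExt (simple k hl w) (simple k hl v) i (-n)) := by
  obtain ⟨R, -⟩ := ObjReps.exists_rep_eq v
  cases i with
  | zero =>
    refine subsingleton_ext_zero hl R w _ (free_hom_eq_zero hl ?_)
    rintro ⟨_, ⟨⟩⟩ ⟨e⟩
    exact absurd ⟨rfl, ⟨e.symm⟩⟩ h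
  | succ m =>
    obtain ⟨q, hq, -⟩ := exists_ker_to_ext hl R w ((simple k hl v).shift (-n)) m
    have : Subsingleton (LinearMap.ker
        (Linear.leftComp k ((simple k hl v).shift (-n)) (barD k l R w (m + 1)))) :=
      ⟨fun φ ψ => Subtype.ext ((bar_succ_hom_eq_zero hl hn _).trans
        (bar_succ_hom_eq_zero hl hn _).symm)⟩
    exact hq.subsingleton

end GrMod
end

theorem mainTheorem2 {k : Type w} [Field k] {C : Type u} [Category.{v} C] (l : CatGrading C)
    (hl : l.IsIndiscretelyBased) (v w : C) (i : ℕ) (n : ℤ) :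
    (n ≠ 0 →
      Nonempty (GrExt (GrMod.simple k hl w) (GrMod.simple k hl v) i (-n) ≃ₗ[k]
        ((p : {p : v ⟶ w // (l.deg p : ℤ) = n}) →
          SemiSSet.redCohomology k (factSSet hl p.1) ((i : ℤ) - 2))) ∧
      ({p : {p : v ⟶ w // (l.deg p : ℤ) = n} |
          Nontrivial (SemiSSet.redCohomology k (factSSet hl p.1) ((i : ℤ) - 2))}.Finite →
        Nonempty (GrExt (GrMod.simple k hl w) (GrMod.simple k hl v) i (-n) ≃ₗ[k]
          DirectSum {p : v ⟶ w // (l.deg p : ℤ) = n} fun p =>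
            SemiSSet.redCohomology k (factSSet hl p.1) ((i : ℤ) - 2)))) ∧
    (n = 0 →
      (i = 0 ∧ Nonempty (v ≅ w) →
        Nonempty (GrExt (GrMod.simple k hl w) (GrMod.simple k hl v) i (-n) ≃ₗ[k] k)) ∧
      (¬ (i = 0 ∧ Nonempty (v ≅ w)) →
        Subsingleton (GrExt (GrMod.simple k hl w) (GrMod.simple k hl v) i (-n)))) := by
  refine ⟨fun hn => ?_, fun hn => ⟨?_, GrMod.subsingleton_ext_deg_zero hl hn⟩⟩
  · obtain ⟨E⟩ := GrMod.ext_equiv (k := k) hl v w hn i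
    refine ⟨⟨E⟩, fun h => ?_⟩
    obtain ⟨E'⟩ := nonempty_pi_linearEquiv_directSum (k := k) h
    exact ⟨E ≪≫ₗ E'⟩
  · rintro ⟨rfl, ⟨e⟩⟩
    exact GrMod.ext_zero_deg_zero_equiv hl e hn
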